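/- **Trees.** A tree is a finite rooted tree whose siblings are unordered; it is stored by adjacency lists (for each node, a list of its children). Two trees are isomorphic, $T_1\simeq T_2$, if there is a bijection $\varphi$ between their nodes that maps root to root and satisfies $v\in\mathrm{children}(u)\iff\varphi(v)\in\mathrm{children}(\varphi(u))$. The depth of $T$ is the maximal depth of a node; $T^d$ is the set of nodes $u$ of level $d=\mathrm{depth}(T)-\mathrm{depth}(u)$; $\#T$ is the number of nodes. **Algorithm PrimesAHU.** On input $T_1,T_2$, compute the levels of both trees by a traversal; if the depths differ, return $\bot$. Let $P=[2,3,5,7,11,13]$ and $N_{\rm sieve}=16$. For $d=0,\dots,\mathrm{depth}(T_1)$: start with the dictionary $f:1\mapsto 2$ and with $p=2$; for all nodes $u$ of $T_1^d$, then all nodes $u$ of $T_2^d$, compute $N(u)=\prod_{v\in\mathrm{children}(u)}c(v)$ by divide and conquer, and if $f(N(u))$ is not defined, replace $p$ by the next prime in $P$ and define $f(N(u))=p$; let $c(u)=f(N(u))$. If the multisets $\{\!\{c(u):u\in T_1^d\}\!\}$ and $\{\!\{c(u):u\in T_2^d\}\!\}$, compared by pigeonhole sort with one hole for each prime used at the level,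 are different, return $\bot$. After the last level return $\top$. If $p$ is the last element of $P$ when a next prime is needed, a segmented sieve of Eratosthenes, which holds all primes up to $N_{\rm sieve}$ in $P$, is first resumed: with $n=\#P+1$, it sieves the integers from $N_{\rm sieve}+1$ to $\lceil n(\ln n+\ln\ln n)\rceil$ (and on to the first new prime, should there be none in this segment), appends the new primes to $P$ and updates $N_{\rm sieve}$. The sieve keeps, for each prime $q\in P$, the next multiple of $q$ to be crossed off, starting at $q^2$, so that resuming it repeats no work. **Running time.** Multiplying two numbers of at most $b$ binary digits costs $M(b)=b\cdot\log b\cdot\log\log b$ steps (Schönhage–Strassen; each logarithm here stands for the number of binary digits of its argument, so that it is at least $1$). Every other elementary operation costs one step: reading, writing or comparing an entry of a list, array or table, crossing off one multiple in the sieve, evaluating the end point of a sieve segment, and looking up or inserting a key in a dictionary of integers (perfect hashing). **Theorem.** (1) For all trees $T_1,T_2$, PrimesAHU terminates and returns $\top$ if and only if $T_1\simeq T_2$. (2) If $\log\#T=O(1)$ for the considered trees, PrimesAHU runs in time $O(n)$, where $n=\#T_1=\#T_2$. Precisely, for every real $K$ there is a constant $C_K$ such that on all trees $T_1,T_2$ with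 $\#T_1=\#T_2=n$ and $\log_2 n\le K$ the running time is at most $C_K\cdot n$; and, so that the statement is not merely one about finitely many trees, $C_K$ can be taken to be a fixed polynomial in $K$. -/

import Mathlib

/-- A rooted tree on the finite node set `V`, given by adjacency lists: a directed graph with a
root that has no parent, in which every node has at most one parent and is reachable from the root
(so every other node has exactly one parent and there is no cycle, directed or undirected).
The order of the list `children u` is the order in which the children are stored in memory;
it plays no role in the notion of isomorphism. -/
structure UnorderedTree (V : Type) where
  root : V
  children : V → List V
  nodup_children : ∀ u, (children u).Nodup
  root_notMem_children : ∀ u, root ∉ children u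
  parent_unique : ∀ u v w, w ∈ children u → w ∈ children v → u = v
  reachable : ∀ v, Relation.ReflTransGen (fun a b => b ∈ children a) root v

/-- Isomorphism of unordered rooted trees. -/
def UnorderedTree.Isomorphic {V₁ V₂ : Type} (T₁ : UnorderedTree V₁) (T₂ : UnorderedTree V₂) : Prop :=
  ∃ φ : V₁ ≃ V₂, φ T₁.root = T₂.root ∧
    ∀ u v, v ∈ T₁.children u ↔ φ v ∈ T₂.children (φ u)

/-- A computation that returns `val` after `time` steps. -/
structure Timed (α : Type) where
  val : α
  time : ℕ

instance : Monad Timed where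
  pure a := ⟨a, 0⟩
  bind x f := ⟨(f x.val).val, x.time + (f x.val).time⟩

/-- Spend `t` steps. -/
def tick (t : ℕ) : Timed Unit := ⟨(), t⟩

/-! ### Arithmetic -/

/-- The Schönhage–Strassen cost `b · log b · log log b` of multiplying two `b`-bit numbers
(each logarithm being replaced by the number of binary digits, which is at least `1`). -/
def mulCost (b : ℕ) : ℕ := b * Nat.size b * Nat.size (Nat.size b)

/-- Multiplication of two numbers, charged by the larger number of binary digits. -/
def timedMul (a b : ℕ) : Timed ℕ := do
  tick (mulCost (max (Nat.size a) (Nat.size b)))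
  return a * b

/-- Divide-and-conquer product of a list of numbers. -/
def timedProd : List ℕ → Timed ℕ
  | [] => do
      tick 1
      return 1
  | [a] => do
      tick 1
      return a
  | a :: b :: l => do
      tick (1 + (a :: b :: l).length)
      let x ← timedProd ((a :: b :: l).take ((a :: b :: l).length / 2))
      let y ← timedProd ((a :: b :: l).drop ((a :: b :: l).length / 2))
      timedMul x y
termination_by xs => xs.length
decreasing_by
  all_goals simp only [List.length_take, List.length_drop, List.length_cons]
  all_goals omega

/-! ### The segmented sieve of Eratosthenes -/

/-- State of a resumable sieve of Eratosthenes: the numbers up to `bound` have been sieved,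
`primes` lists the primes up to `bound` in ascending order, and `table m`, for `m > bound`, lists
the primes `q` whose next multiple to be crossed off (the least multiple of `q` that is larger
than `bound` and at least `q ^ 2`) is `m`. -/
structure SieveState where
  bound : ℕ
  primes : Array ℕ
  table : ℕ → List ℕ

/-- The sieve up to `16`. -/
def initialSieve : SieveState where
  bound := 16
  primes := #[2, 3, 5, 7, 11, 13]
  table := fun m =>
    if m = 18 then [2, 3] else if m = 25 then [5] else if m = 49 then [7]
    else if m = 121 then [11] else if m = 169 then [13] else []

/-- Advance to its next multiple each prime of the list that has just crossed off `m`. -/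
def advance (m : ℕ) : List ℕ → (ℕ → List ℕ) → Timed (ℕ → List ℕ)
  | [], t => return t
  | q :: qs, t => do
      tick 1
      advance m qs (Function.update t (m + q) (q :: t (m + q)))

/-- Sieve one more integer `m`: it is prime if and only if no smaller prime crosses it off.
A new prime `m` starts crossing off its multiples at `m * m`. -/
def sieveStep (s : SieveState) : Timed SieveState := do
  let m := s.bound + 1
  tick 1
  match s.table m with
  | [] => do
      let sq ← timedMul m m
      tick 2
      return ⟨m, s.primes.push m, Function.update s.table sq (m :: s.table sq)⟩
  | q :: qs => do
      let t ← advance m (q :: qs) s.table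
      tick 1
      return ⟨m, s.primes, t⟩

/-- Sieve until the integer `goal` has been reached and at least `n` primes are known.
The first argument only bounds the depth of the recursion. -/
def sieveLoop : ℕ → ℕ → ℕ → SieveState → Timed SieveState
  | 0, _, _, s => return s
  | fuel + 1, goal, n, s => do
      tick 1
      if goal ≤ s.bound ∧ n ≤ s.primes.size then
        return s
      else
        let s' ← sieveStep s
        sieveLoop fuel goal n s'

/-- Resume the sieve in order to generate the `n`-th prime, where `n - 1` primes are known: sieve
the segment that starts after `bound` and ends at `⌈n (ln n + ln ln n)⌉`, or at the first new prime
if that is larger. The bound `goal + bound` on the number of integers to sieve suffices, since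
there is a prime between `bound` and `2 * bound`. -/
noncomputable def sieveOfEratosthenes (s : SieveState) : Timed SieveState := do
  let n := s.primes.size + 1
  let goal := ⌈(n : ℝ) * (Real.log n + Real.log (Real.log n))⌉₊
  tick 1
  sieveLoop (goal + s.bound) goal n s

/-- The next prime not yet used at the current level; `k` is the position in the list of primes of
the last prime used. Returns the new sieve and the position `k + 1`. -/
noncomputable def nextPrime (s : SieveState) (k : ℕ) : Timed (SieveState × ℕ) := do
  tick 1
  if k + 1 = s.primes.size then
    let s' ← sieveOfEratosthenes s
    return (s', k + 1)
  else
    return (s, k + 1)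

/-! ### The levels of a tree -/

/-- The concatenation of the lists of children of the given nodes. -/
def expand {V : Type} (T : UnorderedTree V) : List V → Timed (List V)
  | [] => return []
  | u :: us => do
      tick (1 + (T.children u).length)
      let rest ← expand T us
      return T.children u ++ rest

/-- The lists of nodes of equal depth, starting from the list `L` and going down.
The first argument only bounds the depth of the recursion. -/
def traverse {V : Type} (T : UnorderedTree V) : ℕ → List V → Timed (List (List V))
  | 0, _ => return []
  | _ + 1, [] => do
      tick 1
      return []
  | fuel + 1, u :: us => do
      tick 1
      let next ← expand T (u :: us)
      let rest ← traverse T fuel next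
      return (u :: us) :: rest

/-- The list `[T^0, T^1, …, T^depth]` of the levels of the tree, the root being alone in the last
one. (A tree with `#V` nodes has at most `#V` levels.) -/
def levels {V : Type} [Fintype V] (T : UnorderedTree V) : Timed (List (List V)) := do
  let ls ← traverse T (Fintype.card V) [T.root]
  tick ls.length
  return ls.reverse

/-! ### The algorithm -/

/-- State of the algorithm within a level: the sieve, the position in the list of primes of the
last prime `p` used at this level, and the dictionary `f`. -/
structure LevelState where
  sieve : SieveState
  pos : ℕ
  f : ℕ → Option ℕ

/-- Give the node `u` its colour, where `c` holds the colours given so far: its children's colours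
are multiplied, and the product is looked up in, or else added to, the dictionary. -/
noncomputable def colourNode {V : Type} [DecidableEq V] (T : UnorderedTree V)
    (st : LevelState) (c : V → ℕ) (u : V) : Timed (LevelState × (V → ℕ)) := do
  tick (1 + (T.children u).length)
  let N ← timedProd ((T.children u).map c)
  tick 1
  match st.f N with
  | some q => do
      tick 1
      return (st, Function.update c u q)
  | none => do
      let r ← nextPrime st.sieve st.pos
      let p := r.1.primes.getD r.2 0
      tick 2
      return (⟨r.1, r.2, Function.update st.f N (some p)⟩, Function.update c u p)

/-- Colour a list of nodes. -/
noncomputable def colourNodes {V : Type} [DecidableEq V] (T : UnorderedTree V) :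
    List V → LevelState → (V → ℕ) → Timed (LevelState × (V → ℕ))
  | [], st, c => return (st, c)
  | u :: us, st, c => do
      let r ← colourNode T st c u
      colourNodes T us r.1 r.2

/-- Pigeonhole sort of the colours of a list of nodes: `h q` counts the nodes of colour `q`. -/
def fillHoles {V : Type} (c : V → ℕ) : List V → (ℕ → ℕ) → Timed (ℕ → ℕ)
  | [], h => return h
  | u :: us, h => do
      tick 1
      fillHoles c us (Function.update h (c u) (h (c u) + 1))

/-- Compare the contents of the holes of the first `k` primes of the list. -/
def compareHoles (primes : Array ℕ) (h₁ h₂ : ℕ → ℕ) : ℕ → Timed Bool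
  | 0 => do
      tick 1
      return true
  | k + 1 => do
      tick 1
      if h₁ (primes.getD k 0) = h₂ (primes.getD k 0) then
        compareHoles primes h₁ h₂ k
      else
        return false

/-- The main loop, over the levels that remain to be processed. The dictionary and the current
prime are reset to `f : 1 ↦ 2` and `p = 2` at each level; the sieve is kept. -/
noncomputable def processLevels {V₁ V₂ : Type} [DecidableEq V₁] [DecidableEq V₂]
    (T₁ : UnorderedTree V₁) (T₂ : UnorderedTree V₂) :
    List (List V₁) → List (List V₂) → SieveState → (V₁ → ℕ) → (V₂ → ℕ) → Timed Bool
  | L₁ :: R₁, L₂ :: R₂, s, c₁, c₂ => do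
      tick 2
      let st : LevelState := ⟨s, 0, Function.update (fun _ => none) 1 (some 2)⟩
      let r₁ ← colourNodes T₁ L₁ st c₁
      let r₂ ← colourNodes T₂ L₂ r₁.1 c₂
      let h₁ ← fillHoles r₁.2 L₁ (fun _ => 0)
      let h₂ ← fillHoles r₂.2 L₂ (fun _ => 0)
      let same ← compareHoles r₂.1.sieve.primes h₁ h₂ (r₂.1.pos + 1)
      if same = true then
        processLevels T₁ T₂ R₁ R₂ r₂.1.sieve r₁.2 r₂.2
      else
        return false
  | _, _, _, _, _ => do
      tick 1
      return true

/-- The algorithm `PrimesAHU`. -/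
noncomputable def primesAHU {V₁ V₂ : Type} [Fintype V₁] [Fintype V₂]
    [DecidableEq V₁] [DecidableEq V₂] (T₁ : UnorderedTree V₁) (T₂ : UnorderedTree V₂) :
    Timed Bool := do
  let L₁ ← levels T₁
  let L₂ ← levels T₂
  tick 1
  if L₁.length = L₂.length then
    tick 2
    processLevels T₁ T₂ L₁ L₂ initialSieve (fun _ => 0) (fun _ => 0)
  else
    return false

/-! ### Timed computations -/

/-! Correctness. The dictionary of a level is an injection into the primes, shared by both trees, so
two nodes of the level get the same colour exactly when the products over their children agree. The
children's colours are primes, hence by unique factorisation (`perm_of_prod_eq`) equal products mean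
equal multisets of colours. If equal colours one level below imply isomorphic subtrees, a
colour-preserving matching of the children then glues to an isomorphism of the larger subtrees;
going up from the empty level below the leaves, this reaches the roots
(`subtreeIso_of_processLevels`). Conversely an isomorphism preserves levels and, level by level,
products and colours, so no comparison fails (`processLevels_of_iso`). Resetting the dictionary is
harmless, because all the children of the nodes of one level lie on one level.

Running time. A level has at most `2 * n` nodes in both trees together, so the sieve is resumed only
to produce one of the first `2 * n + 1` primes. Chebyshev's bound keeps the sieve, and with it all
colours, below some `b = O(n log n)`. Sieving is amortised: one integer costs a polylogarithmic
amount, and no integer is sieved twice, so time is charged against the growth of `bound`, across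
nodes and levels. A product of `k` colours costs `k` times a polylogarithm by divide and conquer,
and the numbers of children add up to less than `n`. Altogether the time is `O(n * L ^ 4)` with `L =
Nat.size n`, and `L` is at most `K + 1`. -/

@[simp] theorem Timed.bind_val {α β : Type} (x : Timed α) (f : α → Timed β) :
    (x >>= f).val = (f x.val).val := rfl

@[simp] theorem Timed.bind_time {α β : Type} (x : Timed α) (f : α → Timed β) :
    (x >>= f).time = x.time + (f x.val).time := rfl

@[simp] theorem Timed.pure_val {α : Type} (a : α) : (pure a : Timed α).val = a := rfl

@[simp] theorem Timed.pure_time {α : Type} (a : α) : (pure a : Timed α).time = 0 := rfl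

@[simp] theorem tick_time (t : ℕ) : (tick t).time = t := rfl

@[simp] theorem timedMul_val (a b : ℕ) : (timedMul a b).val = a * b := rfl

@[simp] theorem timedMul_time (a b : ℕ) :
    (timedMul a b).time = mulCost (max (Nat.size a) (Nat.size b)) := rfl

/-! ### Binary digits -/

theorem Nat.size_mul_le (a b : ℕ) : Nat.size (a * b) ≤ Nat.size a + Nat.size b := by
  rw [Nat.size_le, pow_add]
  exact Nat.mul_lt_mul'' (Nat.lt_size_self a) (Nat.lt_size_self b)

theorem Nat.size_le_self (a : ℕ) : Nat.size a ≤ a :=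
  Nat.size_le.2 Nat.lt_two_pow_self

theorem Nat.size_le_half_add_one (a : ℕ) : Nat.size a ≤ a / 2 + 1 := by
  rw [Nat.size_le]
  have : a / 2 < 2 ^ (a / 2) := Nat.lt_two_pow_self
  rw [pow_succ]
  omega

theorem mulCost_mono : Monotone mulCost := by
  intro a b h
  have h₁ := Nat.size_le_size h
  exact Nat.mul_le_mul (Nat.mul_le_mul h h₁) (Nat.size_le_size h₁)

theorem mulCost_le_mul_sq {b k : ℕ} (h : Nat.size b ≤ k) : mulCost b ≤ b * k ^ 2 := by
  have h₁ := (Nat.size_le_self (Nat.size b)).trans h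
  calc mulCost b ≤ b * k * k := Nat.mul_le_mul (Nat.mul_le_mul_left _ h) h₁
    _ = b * k ^ 2 := by ring

/-! ### Divide-and-conquer products -/

@[simp] theorem timedProd_val (l : List ℕ) : (timedProd l).val = l.prod := by
  induction l using timedProd.induct with
  | case1 => simp [timedProd]
  | case2 a => simp [timedProd]
  | case3 a b l ih₁ ih₂ =>
    rw [timedProd]
    simp only [Timed.bind_val, timedMul_val, ih₁, ih₂]
    exact List.prod_take_mul_prod_drop _ _

theorem size_prod_le {S : ℕ} (l : List ℕ) (h : ∀ a ∈ l, Nat.size a ≤ S) :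
    Nat.size l.prod ≤ l.length * S + 1 := by
  have h₁ : l.prod ≤ (2 ^ S) ^ l.length :=
    List.prod_le_pow_card _ _ fun a ha => (Nat.size_le.1 (h a ha)).le
  rw [Nat.size_le, pow_succ]
  rw [← pow_mul, mul_comm S] at h₁
  have : 0 < 2 ^ (l.length * S) := by positivity
  omega

/-- A product of `k` factors has at most `k * (S + 1)` bits, and `g` is a multiplication budget per
factor. Being linear in `k`, the budgets of the two halves add up, so each of the `Nat.clog 2 k`
layers of the recursion costs `2 + g` per factor. Restricting `hg` to `k ≤ m` lets `g` be
polylogarithmic in `m`. -/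
theorem timedProd_time_le {S g : ℕ} (m : ℕ)
    (hg : ∀ k, k ≤ m → mulCost (k * (S + 1)) ≤ k * g) (l : List ℕ)
    (hm : l.length ≤ m) (h : ∀ a ∈ l, Nat.size a ≤ S) :
    (timedProd l).time ≤ 1 + l.length * (Nat.clog 2 l.length * (2 + g)) := by
  induction l using timedProd.induct with
  | case1 => simp [timedProd]
  | case2 a => simp [timedProd]
  | case3 a b l ih₁ ih₂ =>
    rw [timedProd]
    set xs := a :: b :: l with hxs
    have hlen : 2 ≤ xs.length := by simp [hxs]
    have ht : (xs.take (xs.length / 2)).length = xs.length / 2 := by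
      rw [List.length_take]; omega
    have hd : (xs.drop (xs.length / 2)).length = xs.length - xs.length / 2 := by
      rw [List.length_drop]
    have hS₁ : ∀ a ∈ xs.take (xs.length / 2), Nat.size a ≤ S :=
      fun a ha => h a (List.mem_of_mem_take ha)
    have hS₂ : ∀ a ∈ xs.drop (xs.length / 2), Nat.size a ≤ S :=
      fun a ha => h a (List.mem_of_mem_drop ha)
    have e₁ := ih₁ (by omega) hS₁
    have e₂ := ih₂ (by omega) hS₂
    have s₁ := size_prod_le _ hS₁
    have s₂ := size_prod_le _ hS₂
    rw [ht] at e₁ s₁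
    rw [hd] at e₂ s₂
    simp only [Timed.bind_time, timedMul_time, tick_time, timedProd_val]
    generalize hk : xs.length = k at *
    -- The larger half has `⌈k / 2⌉` factors, for which the ceiling logarithm is exactly one less.
    have c₀ : Nat.clog 2 k = Nat.clog 2 ((k + 1) / 2) + 1 := by
      rw [Nat.clog_of_two_le one_lt_two hlen]; simp
    have c₁ : Nat.clog 2 (k / 2) ≤ Nat.clog 2 ((k + 1) / 2) := Nat.clog_mono_right _ (by omega)
    have c₂ : Nat.clog 2 (k - k / 2) = Nat.clog 2 ((k + 1) / 2) := by congr 1; omega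
    have hmul : mulCost (max (Nat.size (xs.take (k / 2)).prod) (Nat.size (xs.drop (k / 2)).prod))
        ≤ k * g := by
      refine (mulCost_mono (max_le (s₁.trans ?_) (s₂.trans ?_))).trans (hg k hm)
      · have := Nat.mul_le_mul_right S (show k / 2 ≤ k by omega)
        rw [mul_add]; omega
      · have := Nat.mul_le_mul_right S (show k - k / 2 ≤ k by omega)
        rw [mul_add]; omega
    rw [c₂] at e₂
    rw [c₀]
    generalize Nat.clog 2 ((k + 1) / 2) = c at *
    have e₃ : k / 2 * (Nat.clog 2 (k / 2) * (2 + g)) ≤ k / 2 * (c * (2 + g)) := by gcongr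
    have e₄ : k / 2 * (c * (2 + g)) + (k - k / 2) * (c * (2 + g)) = k * (c * (2 + g)) := by
      rw [← add_mul]; congr 1; omega
    have e₅ : k * ((c + 1) * (2 + g)) = k * (c * (2 + g)) + 2 * k + k * g := by ring
    omega

/-! ### Primes below a bound -/

/-- Each prime power in the least common multiple of `1, …, n` is at most `n`, so that multiple is
at most `n ^ π(n)`; on the other hand it is at least `2 ^ n / (n + 1)`. Compare exponents of `2`. -/
theorem le_size_mul_primeCounting (n : ℕ) :
    n ≤ Nat.size n * (Nat.primeCounting n + 1) := by
  rcases Nat.eq_zero_or_pos n with rfl | hn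
  · simp
  have h₁ : Nat.lcmUpto n ≤ n ^ Nat.primeCounting n := by
    rw [Nat.lcmUpto_eq_prod_pow_log, ← Nat.primesLE_card_eq_primeCounting]
    exact Finset.prod_le_pow_card _ _ _ fun p _ => Nat.pow_log_le_self p hn.ne'
  have h₂ : 2 ^ n ≤ 2 ^ (Nat.size n * (Nat.primeCounting n + 1)) :=
    calc 2 ^ n ≤ (n + 1) * Nat.lcmUpto n := Chebyshev.two_pow_le_mul_lcmUpto n
      _ ≤ (n + 1) * (n + 1) ^ Nat.primeCounting n :=
        Nat.mul_le_mul_left _ (h₁.trans (Nat.pow_le_pow_left (Nat.le_succ n) _))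
      _ = (n + 1) ^ (Nat.primeCounting n + 1) := by ring
      _ ≤ (2 ^ Nat.size n) ^ (Nat.primeCounting n + 1) :=
        Nat.pow_le_pow_left (Nat.lt_size_self n) _
      _ = _ := by rw [pow_mul]
  exact (Nat.pow_le_pow_iff_right one_lt_two).1 h₂

/-- A form of Chebyshev's bound: `B = O(m log m)` if there are less than `m` primes up to `B`. -/
theorem le_mul_size_of_primeCounting_lt {B m : ℕ} (h : Nat.primeCounting B < m) :
    B ≤ m * (5 * Nat.size m) := by
  have h₁ : B ≤ Nat.size B * m :=
    (le_size_mul_primeCounting B).trans (Nat.mul_le_mul_left _ h)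
  -- Bootstrapping: the unknown `Nat.size B` bounds itself up to its own size, and
  -- `Nat.size_le_half_add_one` lets half of it be absorbed on the left.
  have h₂ : Nat.size B ≤ Nat.size (Nat.size B) + Nat.size m :=
    (Nat.size_le_size h₁).trans (Nat.size_mul_le _ _)
  have h₃ := Nat.size_le_half_add_one (Nat.size B)
  have h₄ : 0 < Nat.size m := Nat.size_pos.2 (by omega)
  have h₅ : Nat.size B ≤ 5 * Nat.size m := by omega
  calc B ≤ Nat.size B * m := h₁
    _ ≤ (5 * Nat.size m) * m := Nat.mul_le_mul_right _ h₅
    _ = _ := mul_comm _ _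

theorem nth_prime_le_of_lt_primeCounting {i b : ℕ} (h : i < Nat.primeCounting b) :
    Nat.nth Nat.Prime i ≤ b :=
  Nat.lt_succ_iff.1 (Nat.nth_lt_of_lt_count h)

theorem nth_prime_injective : Function.Injective (Nat.nth Nat.Prime) :=
  Nat.nth_injective Nat.infinite_setOfPred_prime

/-- Distinct prime divisors multiply to at most `m`, and each is at least `2`. This bounds how many
primes can cross off one integer. -/
theorem length_le_size_of_primes_dvd {m : ℕ} (hm : m ≠ 0) {l : List ℕ} (hl : l.Nodup)
    (h : ∀ q ∈ l, q.Prime ∧ q ∣ m) : l.length ≤ Nat.size m := by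
  have h₁ : l.toFinset ⊆ m.primeFactors := fun q hq =>
    Nat.mem_primeFactors.2 ⟨(h q (List.mem_toFinset.1 hq)).1, (h q (List.mem_toFinset.1 hq)).2, hm⟩
  have h₂ : l.length ≤ m.primeFactors.card := by
    rw [← List.toFinset_card_of_nodup hl]; exact Finset.card_le_card h₁
  have h₃ : 2 ^ m.primeFactors.card ≤ m := by
    calc 2 ^ m.primeFactors.card ≤ ∏ p ∈ m.primeFactors, p :=
          Finset.pow_card_le_prod _ _ _ fun p hp => (Nat.prime_of_mem_primeFactors hp).two_le
      _ ≤ m := Nat.le_of_dvd (Nat.pos_of_ne_zero hm) (Nat.prod_primeFactors_dvd m)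
  have := Nat.lt_size.2 h₃
  omega

/-! ### The sieve -/

/-- `primes` holds the primes up to `bound`, and beyond `bound` the table files every such prime
under its next multiple to be crossed off. -/
structure SieveState.Valid (s : SieveState) : Prop where
  sixteen_le : 16 ≤ s.bound
  size_eq : s.primes.size = Nat.primeCounting s.bound
  getD_eq : ∀ i < s.primes.size, s.primes.getD i 0 = Nat.nth Nat.Prime i
  nodup_table : ∀ m, s.bound < m → (s.table m).Nodup
  -- The last disjunction expresses minimality: either crossing off has not passed its start `q *
  -- q`, or `m` is the only multiple of `q` in the window of length `q` after `bound`.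
  mem_table : ∀ m, s.bound < m → ∀ q, q ∈ s.table m ↔
    q.Prime ∧ q ≤ s.bound ∧ q ∣ m ∧ q * q ≤ m ∧ (m = q * q ∨ m ≤ s.bound + q)

theorem primeCounting_sixteen : Nat.primeCounting 16 = 6 := by decide +kernel

theorem initialSieve_valid : initialSieve.Valid where
  sixteen_le := le_rfl
  size_eq := primeCounting_sixteen.symm
  getD_eq i hi := by
    change i < 6 at hi
    have h13 : Nat.nth Nat.Prime 5 = 13 := Nat.nth_count (p := Nat.Prime) (n := 13) (by norm_num)
    interval_cases i <;> simp [initialSieve, h13]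
  nodup_table m _ := by
    simp only [initialSieve]
    split_ifs <;> simp
  mem_table m hm q := by
    change 16 < m at hm
    simp only [initialSieve]
    constructor
    · split_ifs <;> subst_vars <;>
        simp only [List.mem_cons, List.not_mem_nil, or_false, false_imp_iff]
      · rintro (rfl | rfl) <;> norm_num
      all_goals rintro rfl; norm_num
    · rintro ⟨hp, hq, hd, hs, h⟩
      interval_cases q <;> first | (norm_num at hp; done) | skip
      · obtain rfl : m = 18 := by omega
        simp
      · obtain rfl : m = 18 := by omega
        simp
      · obtain rfl : m = 25 := by omega
        simp
      · obtain rfl : m = 49 := by omega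
        simp
      · obtain rfl : m = 121 := by omega
        simp
      · obtain rfl : m = 169 := by omega
        simp

@[simp] theorem advance_time (m : ℕ) (qs : List ℕ) (t : ℕ → List ℕ) :
    (advance m qs t).time = qs.length := by
  induction qs generalizing t with
  | nil => rfl
  | cons q qs ih => simp [advance, ih, add_comm]

theorem mem_advance {m q x : ℕ} {qs : List ℕ} {t : ℕ → List ℕ} :
    q ∈ (advance m qs t).val x ↔ q ∈ t x ∨ (q ∈ qs ∧ x = m + q) := by
  induction qs generalizing t with
  | nil => simp [advance]
  | cons p qs ih =>
    simp only [advance, Timed.bind_val, ih, List.mem_cons, Function.update_apply]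
    split_ifs with h
    · subst h; simp only [List.mem_cons]; constructor
      · rintro ((rfl | h) | h)
        · simp
        · exact Or.inl h
        · exact Or.inr ⟨Or.inr h.1, h.2⟩
      · rintro (h | ⟨rfl | h, h'⟩)
        · simp [h]
        · simp
        · exact Or.inr ⟨h, h'⟩
    · constructor
      · rintro (h | h)
        · exact Or.inl h
        · exact Or.inr ⟨Or.inr h.1, h.2⟩
      · rintro (h | ⟨rfl | h, h'⟩)
        · exact Or.inl h
        · exact absurd h' h
        · exact Or.inr ⟨h, h'⟩

theorem nodup_advance {m x : ℕ} {qs : List ℕ} {t : ℕ → List ℕ} (hqs : qs.Nodup)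
    (h : ∀ q ∈ qs, q ∉ t (m + q)) (ht : (t x).Nodup) : ((advance m qs t).val x).Nodup := by
  induction qs generalizing t with
  | nil => exact ht
  | cons p qs ih =>
    simp only [advance, Timed.bind_val]
    rw [List.nodup_cons] at hqs
    refine ih hqs.2 (fun q hq => ?_) ?_
    · have hne : q ≠ p := fun e => hqs.1 (e ▸ hq)
      rw [Function.update_of_ne (by omega)]
      exact h q (List.mem_cons_of_mem _ hq)
    · rw [Function.update_apply]
      split_ifs with e
      · subst e
        exact List.nodup_cons.2 ⟨h p List.mem_cons_self, ht⟩
      · exact ht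

/-- If `bound + 1` is composite, its least prime factor `q` satisfies `q * q ≤ bound + 1` and is
filed there; conversely every filed prime is a proper divisor. -/
theorem SieveState.Valid.prime_succ_iff {s : SieveState} (hs : s.Valid) :
    (s.bound + 1).Prime ↔ s.table (s.bound + 1) = [] := by
  have h16 := hs.sixteen_le
  rw [List.eq_nil_iff_forall_not_mem]
  constructor
  · intro hp q hq
    obtain ⟨h₁, h₂, h₃, -⟩ := (hs.mem_table _ (Nat.lt_succ_self _) q).1 hq
    have := (Nat.prime_dvd_prime_iff_eq h₁ hp).1 h₃
    omega
  · intro h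
    by_contra hp
    have hq := Nat.minFac_prime (n := s.bound + 1) (by omega)
    have hd := Nat.minFac_dvd (s.bound + 1)
    have hsq := Nat.minFac_sq_le_self (n := s.bound + 1) (by omega) hp
    refine h _ ((hs.mem_table _ (Nat.lt_succ_self _) (s.bound + 1).minFac).2
      ⟨hq, ?_, hd, ?_, Or.inr ?_⟩)
    · have := Nat.minFac_le (n := s.bound + 1) (by omega)
      rcases this.lt_or_eq with h | h
      · omega
      · exact absurd (h ▸ hq) hp
    · rwa [← sq]
    · have := hq.two_le; omega

theorem primeCounting_succ_of_prime {b : ℕ} (h : (b + 1).Prime) :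
    Nat.primeCounting (b + 1) = Nat.primeCounting b + 1 := by
  simp [Nat.primeCounting, Nat.primeCounting', Nat.count_succ _ (b + 1), h]

theorem primeCounting_succ_of_not_prime {b : ℕ} (h : ¬ (b + 1).Prime) :
    Nat.primeCounting (b + 1) = Nat.primeCounting b := by
  simp [Nat.primeCounting, Nat.primeCounting', Nat.count_succ _ (b + 1), h]

theorem sieveStep_bound (s : SieveState) : (sieveStep s).val.bound = s.bound + 1 := by
  simp only [sieveStep, Timed.bind_val]
  split <;> rfl

theorem SieveState.Valid.sieveStep {s : SieveState} (hs : s.Valid) :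
    (sieveStep s).val.Valid := by
  have h16 := hs.sixteen_le
  have hprime := hs.prime_succ_iff
  have hlt : s.bound < s.bound + 1 := Nat.lt_succ_self _
  simp only [_root_.sieveStep, Timed.bind_val]
  split
  next heq =>
    have hp := hprime.2 heq
    have hsq : s.bound + 1 < (s.bound + 1) * (s.bound + 1) := by nlinarith
    refine ⟨by simp; omega, ?_, ?_, ?_, ?_⟩
    · simp [primeCounting_succ_of_prime hp, hs.size_eq]
    · intro i hi
      simp only [Timed.bind_val, Timed.pure_val, Array.size_push] at hi ⊢
      rcases Nat.lt_succ_iff_lt_or_eq.1 hi with hi | rfl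
      · rw [← hs.getD_eq i hi]
        simp [Array.getD, hi, Nat.lt_succ_of_lt hi, Array.getElem_push]
      · have h : Nat.nth Nat.Prime s.primes.size = s.bound + 1 := by
          rw [hs.size_eq]
          exact Nat.nth_count hp
        rw [h]
        simp [Array.getD]
    · intro x hx
      simp only [Timed.bind_val, Timed.pure_val, timedMul_val, Function.update_apply] at hx ⊢
      split_ifs with h
      · subst h
        refine List.nodup_cons.2 ⟨fun hm => ?_, hs.nodup_table _ (by omega)⟩
        have := ((hs.mem_table _ (by omega) _).1 hm).2.1
        omega
      · exact hs.nodup_table _ (by omega)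
    · intro x hx q
      simp only [Timed.bind_val, Timed.pure_val, timedMul_val] at hx ⊢
      have key : q ∈ Function.update s.table ((s.bound + 1) * (s.bound + 1))
          ((s.bound + 1) :: s.table ((s.bound + 1) * (s.bound + 1))) x ↔
          q ∈ s.table x ∨ (q = s.bound + 1 ∧ x = (s.bound + 1) * (s.bound + 1)) := by
        rw [Function.update_apply]
        split_ifs with h
        · subst h; simp [or_comm]
        · simp [h]
      rw [key, hs.mem_table x (by omega)]
      constructor
      · rintro (⟨h₁, h₂, h₃, h₄, h₅⟩ | ⟨rfl, rfl⟩)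
        · exact ⟨h₁, by omega, h₃, h₄, by omega⟩
        · exact ⟨hp, le_rfl, dvd_mul_left _ _, le_rfl, Or.inl rfl⟩
      · rintro ⟨h₁, h₂, h₃, h₄, h₅⟩
        rcases h₂.lt_or_eq with h | rfl
        · refine Or.inl ⟨h₁, by omega, h₃, h₄, ?_⟩
          rcases h₅ with h₅ | h₅
          · exact Or.inl h₅
          -- In the boundary case `x = bound + 1 + q`, the prime `q` would divide the larger prime
          -- `bound + 1`.
          · rcases h₅.lt_or_eq with h₆ | rfl
            · exact Or.inr (by omega)
            · have := (Nat.prime_dvd_prime_iff_eq h₁ hp).1 ((Nat.dvd_add_left dvd_rfl).1 h₃)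
              omega
        · refine Or.inr ⟨rfl, ?_⟩
          rcases h₅ with h₅ | h₅
          · exact h₅
          · nlinarith
  next p qs heq =>
    have hp : ¬ (s.bound + 1).Prime := by rw [hprime, heq]; simp
    rw [← heq]
    refine ⟨by simp; omega, ?_, ?_, ?_, ?_⟩
    · simp [primeCounting_succ_of_not_prime hp, hs.size_eq]
    · exact hs.getD_eq
    · intro x hx
      simp only [Timed.bind_val, Timed.pure_val] at hx ⊢
      refine nodup_advance (hs.nodup_table _ hlt) (fun q hq hq' => ?_) (hs.nodup_table _ (by omega))
      have h₁ := (hs.mem_table _ hlt q).1 hq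
      have h₂ := (hs.mem_table _ (by omega) q).1 hq'
      have := h₁.1.two_le
      omega
    · intro x hx q
      simp only [Timed.bind_val, Timed.pure_val] at hx ⊢
      rw [mem_advance, hs.mem_table x (by omega), hs.mem_table _ hlt]
      constructor
      · rintro (⟨h₁, h₂, h₃, h₄, h₅⟩ | ⟨⟨h₁, h₂, h₃, h₄, h₅⟩, rfl⟩)
        · exact ⟨h₁, by omega, h₃, h₄, by omega⟩
        · exact ⟨h₁, by omega, (Nat.dvd_add_left dvd_rfl).2 h₃, by omega, Or.inr le_rfl⟩
      · rintro ⟨h₁, h₂, h₃, h₄, h₅⟩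
        have h₂' : q ≠ s.bound + 1 := by rintro rfl; exact hp h₁
        by_cases h₆ : x = q * q
        · exact Or.inl ⟨h₁, by omega, h₃, h₄, Or.inl h₆⟩
        have h₇ : x ≤ s.bound + 1 + q := by omega
        rcases h₇.lt_or_eq with h₇ | rfl
        · exact Or.inl ⟨h₁, by omega, h₃, h₄, Or.inr (by omega)⟩
        · have h₈ : q ∣ s.bound + 1 := (Nat.dvd_add_left dvd_rfl).1 h₃
          refine Or.inr ⟨⟨h₁, by omega, h₈, ?_, Or.inr (by have := h₁.two_le; omega)⟩, rfl⟩
          -- `q * q` and `bound + 1 + q` are distinct multiples of `q`, so `q * q ≤ bound + 1 + q`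
          -- improves to `q * q ≤ bound + 1`.
          obtain ⟨a, ha⟩ := h₈
          rw [ha] at h₄ h₆ ⊢
          refine Nat.mul_le_mul_left _ ?_
          by_contra! hlt'
          have : q * (a + 1) ≤ q * q := Nat.mul_le_mul_left _ hlt'
          rw [mul_add, mul_one] at this
          omega

/-- A bound for the cost of sieving one integer of at most `b` binary digits. -/
def sieveStepCost (b : ℕ) : ℕ := mulCost b + b + 3

theorem SieveState.Valid.sieveStep_time_le {s : SieveState} (hs : s.Valid) :
    (_root_.sieveStep s).time ≤ sieveStepCost (Nat.size (s.bound + 1)) := by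
  have hlt : s.bound < s.bound + 1 := Nat.lt_succ_self _
  have hlen := length_le_size_of_primes_dvd (m := s.bound + 1) (Nat.succ_ne_zero _) (hs.nodup_table _ hlt)
    fun q hq => ⟨((hs.mem_table _ hlt q).1 hq).1, ((hs.mem_table _ hlt q).1 hq).2.2.1⟩
  simp only [_root_.sieveStep, Timed.bind_time, tick_time, sieveStepCost]
  split
  next heq => simp; omega
  next p qs heq =>
    rw [heq] at hlen
    simp only [Timed.bind_time, tick_time, advance_time, Timed.pure_time]
    omega

/-- The time estimate is amortised, with a multiple of `bound` as potential; writing it as a sum on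
both sides avoids subtraction and lets successive calls telescope. The rate refers to an arbitrary
`b` above the final bound, so that one rate serves the entire run. -/
theorem SieveState.Valid.sieveLoop {s : SieveState} (hs : s.Valid) (fuel goal n : ℕ) :
    (sieveLoop fuel goal n s).val.Valid ∧
      s.bound ≤ (sieveLoop fuel goal n s).val.bound ∧
      (sieveLoop fuel goal n s).val.bound ≤ s.bound + fuel ∧
      (n ≤ (sieveLoop fuel goal n s).val.primes.size ∨
        (sieveLoop fuel goal n s).val.bound = s.bound + fuel) ∧
      ∀ b, (sieveLoop fuel goal n s).val.bound ≤ b →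
        (sieveLoop fuel goal n s).time + (sieveStepCost (Nat.size b) + 1) * s.bound ≤
          1 + (sieveStepCost (Nat.size b) + 1) * (sieveLoop fuel goal n s).val.bound := by
  induction fuel generalizing s with
  | zero => exact ⟨hs, le_rfl, le_rfl, Or.inr rfl, fun b _ => by simp [_root_.sieveLoop]⟩
  | succ fuel ih =>
    simp only [_root_.sieveLoop, Timed.bind_val, Timed.bind_time, tick_time]
    split_ifs with h
    · exact ⟨hs, le_rfl, by simp, Or.inl h.2, fun b _ => by simp⟩
    · obtain ⟨h₁, h₂, h₃, h₄, h₅⟩ := ih hs.sieveStep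
      have ht := hs.sieveStep_time_le
      rw [sieveStep_bound] at h₂ h₃ h₄ h₅
      simp only [Timed.bind_val, Timed.bind_time]
      refine ⟨h₁, by omega, by omega, by omega, fun b hb => ?_⟩
      have h₆ := h₅ b hb
      have h₇ : sieveStepCost (Nat.size (s.bound + 1)) ≤ sieveStepCost (Nat.size b) := by
        have := Nat.size_le_size (show s.bound + 1 ≤ b by omega)
        have := mulCost_mono this
        unfold sieveStepCost
        omega
      rw [mul_add (sieveStepCost (Nat.size b) + 1) s.bound 1] at h₆
      omega

/-- Follows from `ln ln m ≤ ln m ≤ Nat.size m`. Only an upper bound is needed: that the segment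
contains a new prime is never used, since the loop also waits for one. -/
theorem segmentEnd_le {m : ℕ} (hm : 3 ≤ m) :
    ⌈(m : ℝ) * (Real.log m + Real.log (Real.log m))⌉₊ ≤ m * (2 * Nat.size m) := by
  have h₀ : (3 : ℝ) ≤ m := by exact_mod_cast hm
  have h₁ : Real.log m ≤ Nat.size m := by
    have h : (m : ℝ) ≤ 2 ^ Nat.size m := by exact_mod_cast (Nat.lt_size_self m).le
    calc Real.log m ≤ Real.log (2 ^ Nat.size m) := Real.log_le_log (by linarith) h
      _ = Nat.size m * Real.log 2 := by rw [Real.log_pow]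
      _ ≤ Nat.size m * 1 := by
        gcongr
        have := Real.log_two_lt_d9
        linarith
      _ = _ := mul_one _
  have h₂ : 0 < Real.log m := Real.log_pos (by linarith)
  have h₃ : Real.log (Real.log m) ≤ Real.log m := by
    have := Real.log_le_sub_one_of_pos h₂
    linarith
  rw [Nat.ceil_le]
  push_cast
  gcongr
  linarith

theorem SieveState.Valid.sieveOfEratosthenes {s : SieveState} (hs : s.Valid) {M : ℕ}
    (hM : s.primes.size + 1 ≤ M) :
    (sieveOfEratosthenes s).val.Valid ∧
      s.primes.size < (sieveOfEratosthenes s).val.primes.size ∧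
      (sieveOfEratosthenes s).val.bound ≤ M * (12 * Nat.size M) ∧
      ∀ b, (sieveOfEratosthenes s).val.bound ≤ b →
        (sieveOfEratosthenes s).time + (sieveStepCost (Nat.size b) + 1) * s.bound ≤
          2 + (sieveStepCost (Nat.size b) + 1) * (sieveOfEratosthenes s).val.bound := by
  have hsize : 6 ≤ s.primes.size := by
    rw [hs.size_eq, ← primeCounting_sixteen]
    exact Nat.monotone_primeCounting hs.sixteen_le
  have hgoal := segmentEnd_le (m := s.primes.size + 1) (by omega)
  simp only [_root_.sieveOfEratosthenes, Timed.bind_val, Timed.bind_time, tick_time]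
  generalize ⌈((s.primes.size + 1 : ℕ) : ℝ) * (Real.log (s.primes.size + 1 : ℕ) +
    Real.log (Real.log (s.primes.size + 1 : ℕ)))⌉₊ = goal at *
  obtain ⟨h₁, h₂, h₃, h₄, h₅⟩ := hs.sieveLoop (goal + s.bound) goal (s.primes.size + 1)
  refine ⟨h₁, ?_, ?_, fun b hb => by have := h₅ b hb; omega⟩
  · rcases h₄ with h₄ | h₄
    · exact h₄
    -- If the fuel ran out, the sieve has at least doubled its bound, and Bertrand's postulate
    -- supplies a new prime.
    · obtain ⟨p, hp, hp₁, hp₂⟩ := Nat.exists_prime_lt_and_le_two_mul s.bound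
        (by have := hs.sixteen_le; omega)
      rw [h₁.size_eq, h₄, hs.size_eq]
      refine lt_of_lt_of_le ?_
        (Nat.monotone_primeCounting (show p ≤ s.bound + (goal + s.bound) by omega))
      obtain ⟨k, rfl⟩ : ∃ k, p = k + 1 := ⟨p - 1, by omega⟩
      rw [primeCounting_succ_of_prime hp, Nat.lt_succ_iff]
      exact Nat.monotone_primeCounting (by omega)
  -- The factor `12` is `5 + 5 + 2`: the old bound twice, by Chebyshev, and the segment end.
  · have hb : s.bound ≤ (s.primes.size + 1) * (5 * Nat.size (s.primes.size + 1)) :=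
      le_mul_size_of_primeCounting_lt (by rw [hs.size_eq]; omega)
    calc _ ≤ s.bound + (goal + s.bound) := h₃
      _ ≤ (s.primes.size + 1) * (12 * Nat.size (s.primes.size + 1)) := by linarith
      _ ≤ _ := Nat.mul_le_mul hM (Nat.mul_le_mul_left _ (Nat.size_le_size hM))

/-- `nextPrime` makes the next prime available, at a cost that is constant apart from that of
sieving. -/
theorem SieveState.Valid.nextPrime {s : SieveState} (hs : s.Valid) {k : ℕ}
    (hk : k < s.primes.size) :
    (nextPrime s k).val.1.Valid ∧ (nextPrime s k).val.2 = k + 1 ∧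
      k + 1 < (nextPrime s k).val.1.primes.size ∧
      ∀ M b, k + 2 ≤ M → M * (12 * Nat.size M) ≤ b → s.bound ≤ b →
        (nextPrime s k).val.1.bound ≤ b ∧
        (nextPrime s k).time + (sieveStepCost (Nat.size b) + 1) * s.bound ≤
          3 + (sieveStepCost (Nat.size b) + 1) * (nextPrime s k).val.1.bound := by
  simp only [_root_.nextPrime, Timed.bind_val, Timed.bind_time, tick_time]
  split_ifs with h
  · obtain ⟨h₁, h₂, h₃, h₄⟩ := hs.sieveOfEratosthenes le_rfl
    refine ⟨h₁, rfl, by rw [h]; exact h₂, fun M b hM hb _ => ?_⟩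
    have h₅ := (hs.sieveOfEratosthenes (M := M) (by omega)).2.2.1.trans hb
    refine ⟨h₅, ?_⟩
    have := h₄ b h₅
    simp only [Timed.bind_val, Timed.bind_time, Timed.pure_val, Timed.pure_time]
    omega
  · refine ⟨hs, rfl, by simp; omega, fun M b _ _ hb => ⟨hb, ?_⟩⟩
    simp only [Timed.pure_val, Timed.pure_time]
    omega

/-! ### Levels of a tree -/

namespace UnorderedTree

variable {V : Type}

/-- The list of the nodes of depth `i`. -/
def level (T : UnorderedTree V) : ℕ → List V
  | 0 => [T.root]
  | i + 1 => (T.level i).flatMap T.children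

/-- The number of the given nodes plus the number of their children. -/
def workload (T : UnorderedTree V) (L : List V) : ℕ := L.length + (L.flatMap T.children).length

theorem workload_cons (T : UnorderedTree V) (u : V) (L : List V) :
    T.workload (u :: L) = 1 + (T.children u).length + T.workload L := by
  simp [workload]; ring

theorem mem_level_succ {T : UnorderedTree V} {i : ℕ} {v : V} :
    v ∈ T.level (i + 1) ↔ ∃ u ∈ T.level i, v ∈ T.children u :=
  List.mem_flatMap

/-- Follow the unique parents upwards from both levels; the root has no parent, so both walks end
together. -/
theorem level_unique {T : UnorderedTree V} {i j : ℕ} {u : V} (hi : u ∈ T.level i)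
    (hj : u ∈ T.level j) : i = j := by
  induction i generalizing u j with
  | zero =>
    obtain rfl : u = T.root := List.mem_singleton.1 hi
    cases j with
    | zero => rfl
    | succ j =>
      obtain ⟨w, -, hw⟩ := mem_level_succ.1 hj
      exact absurd hw (T.root_notMem_children w)
  | succ i ih =>
    obtain ⟨w, hw, hu⟩ := mem_level_succ.1 hi
    cases j with
    | zero =>
      obtain rfl : u = T.root := List.mem_singleton.1 hj
      exact absurd hu (T.root_notMem_children w)
    | succ j =>
      obtain ⟨w', hw', hu'⟩ := mem_level_succ.1 hj
      obtain rfl := T.parent_unique _ _ _ hu hu'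
      rw [ih hw hw']

/-- Colours are overwritten while a level is processed; this guarantees that the children's colours
being read are not among them. -/
theorem children_notMem_level {T : UnorderedTree V} {i : ℕ} {u x : V} (hu : u ∈ T.level i)
    (hx : x ∈ T.children u) : x ∉ T.level i := fun h =>
  absurd (level_unique h (mem_level_succ.2 ⟨u, hu, hx⟩)) (by omega)

theorem nodup_level (T : UnorderedTree V) (i : ℕ) : (T.level i).Nodup := by
  induction i with
  | zero => exact List.nodup_singleton _
  | succ i ih =>
    refine List.nodup_flatMap.2 ⟨fun u _ => T.nodup_children u, ih.imp fun hne => ?_⟩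
    exact fun x h₁ h₂ => hne (T.parent_unique _ _ _ h₁ h₂)

theorem nodup_flatMap_level (T : UnorderedTree V) (k : ℕ) :
    ((List.range k).flatMap T.level).Nodup := by
  refine List.nodup_flatMap.2 ⟨fun i _ => T.nodup_level i, List.nodup_range.imp fun hne => ?_⟩
  exact fun x h₁ h₂ => hne (level_unique h₁ h₂)

variable [Fintype V]

theorem sum_length_level_le (T : UnorderedTree V) (k : ℕ) :
    ∑ i ∈ Finset.range k, (T.level i).length ≤ Fintype.card V := by
  refine le_trans (le_of_eq ?_) (T.nodup_flatMap_level k).length_le_card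
  rw [List.length_flatMap, ← List.sum_toFinset _ List.nodup_range, List.toFinset_range]

theorem sum_workload_level_le (T : UnorderedTree V) (k : ℕ) :
    ∑ i ∈ Finset.range k, T.workload (T.level i) ≤ 2 * Fintype.card V := by
  have h₁ := T.sum_length_level_le k
  have h₂ := T.sum_length_level_le (k + 1)
  rw [Finset.sum_range_succ'] at h₂
  have h₃ : ∑ i ∈ Finset.range k, T.workload (T.level i) =
      ∑ i ∈ Finset.range k, (T.level i).length +
        ∑ i ∈ Finset.range k, (T.level (i + 1)).length := by
    rw [← Finset.sum_add_distrib]; rfl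
  omega

theorem exists_level_eq_nil (T : UnorderedTree V) : ∃ h, T.level h = [] := by
  by_contra! hne
  have h₁ := T.sum_length_level_le (Fintype.card V + 1)
  have h₂ : ∑ i ∈ Finset.range (Fintype.card V + 1), 1 ≤
      ∑ i ∈ Finset.range (Fintype.card V + 1), (T.level i).length :=
    Finset.sum_le_sum fun i _ => List.length_pos_iff.2 (hne i)
  simp at h₂
  omega

open Classical in
/-- The number of levels of the tree. -/
noncomputable def numLevels (T : UnorderedTree V) : ℕ := Nat.find T.exists_level_eq_nil

theorem level_numLevels (T : UnorderedTree V) : T.level T.numLevels = [] := by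
  classical exact Nat.find_spec T.exists_level_eq_nil

theorem level_ne_nil {T : UnorderedTree V} {i : ℕ} (h : i < T.numLevels) : T.level i ≠ [] := by
  classical exact Nat.find_min T.exists_level_eq_nil h

theorem numLevels_le_card (T : UnorderedTree V) : T.numLevels ≤ Fintype.card V := by
  refine le_trans ?_ (T.sum_length_level_le T.numLevels)
  calc T.numLevels = ∑ i ∈ Finset.range T.numLevels, 1 := by simp
    _ ≤ _ := Finset.sum_le_sum fun i hi =>
      List.length_pos_iff.2 (level_ne_nil (Finset.mem_range.1 hi))

end UnorderedTree

theorem expand_val {V : Type} (T : UnorderedTree V) (L : List V) :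
    (expand T L).val = L.flatMap T.children := by
  induction L with
  | nil => rfl
  | cons u us ih => simp [expand, ih]

theorem expand_time {V : Type} (T : UnorderedTree V) (L : List V) :
    (expand T L).time = T.workload L := by
  induction L with
  | nil => rfl
  | cons u us ih => simp [expand, ih, UnorderedTree.workload_cons]

theorem traverse_level {V : Type} (T : UnorderedTree V) {fuel j k : ℕ} (hj : j ≤ fuel)
    (hnil : T.level (k + j) = []) (hne : ∀ i < j, T.level (k + i) ≠ []) :
    (traverse T fuel (T.level k)).val = (List.range j).map (fun i => T.level (k + i)) ∧
      (traverse T fuel (T.level k)).time ≤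
        1 + j + ∑ i ∈ Finset.range j, T.workload (T.level (k + i)) := by
  induction j generalizing fuel k with
  | zero =>
    rw [Nat.add_zero] at hnil
    rw [hnil]
    cases fuel <;> simp [_root_.traverse]
  | succ j ih =>
    obtain ⟨fuel, rfl⟩ : ∃ f, fuel = f + 1 := ⟨fuel - 1, by omega⟩
    obtain ⟨u, us, hu⟩ := List.exists_cons_of_ne_nil (hne 0 (Nat.succ_pos j))
    rw [Nat.add_zero] at hu
    obtain ⟨h₁, h₂⟩ := ih (fuel := fuel) (k := k + 1) (by omega)
      (by rw [← hnil]; congr 1; omega)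
      (fun i hi => by have := hne (i + 1) (by omega); rwa [add_right_comm, add_assoc])
    have hx : (expand T (u :: us)).val = T.level (k + 1) := by rw [expand_val, ← hu]; rfl
    have hadd : ∀ i, k + 1 + i = k + (i + 1) := fun i => by omega
    simp only [hadd] at h₁ h₂
    rw [hu]
    simp only [_root_.traverse, Timed.bind_val, Timed.bind_time, Timed.pure_val, Timed.pure_time,
      tick_time, hx, expand_time, h₁]
    constructor
    · rw [List.range_succ_eq_map]
      simp [hu, Function.comp_def]
    · rw [Finset.sum_range_succ', add_zero k, hu]
      omega

/-- The first `k` levels of the tree, the deepest one first. -/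
def UnorderedTree.levelsUpTo {V : Type} (T : UnorderedTree V) : ℕ → List (List V)
  | 0 => []
  | k + 1 => T.level k :: T.levelsUpTo k

theorem UnorderedTree.levelsUpTo_eq {V : Type} (T : UnorderedTree V) (k : ℕ) :
    T.levelsUpTo k = ((List.range k).map T.level).reverse := by
  induction k with
  | zero => rfl
  | succ k ih => simp [levelsUpTo, ih, List.range_succ]

@[simp] theorem UnorderedTree.length_levelsUpTo {V : Type} (T : UnorderedTree V) (k : ℕ) :
    (T.levelsUpTo k).length = k := by
  simp [levelsUpTo_eq]

theorem levels_val {V : Type} [Fintype V] (T : UnorderedTree V) :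
    (levels T).val = T.levelsUpTo T.numLevels := by
  have h := (traverse_level T (k := 0) T.numLevels_le_card (by simpa using T.level_numLevels)
    (fun i hi => by simpa using UnorderedTree.level_ne_nil hi)).1
  simp only [Nat.zero_add] at h
  rw [UnorderedTree.levelsUpTo_eq, ← h]
  rfl

theorem levels_time_le {V : Type} [Fintype V] (T : UnorderedTree V) :
    (levels T).time ≤ 1 + 4 * Fintype.card V := by
  have h := traverse_level T (k := 0) T.numLevels_le_card (by simpa using T.level_numLevels)
    (fun i hi => by simpa using UnorderedTree.level_ne_nil hi)
  simp only [Nat.zero_add] at h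
  have h₁ := T.sum_workload_level_le T.numLevels
  have h₂ := T.numLevels_le_card
  have h₃ : (levels T).time = (traverse T (Fintype.card V) (T.level 0)).time +
      ((traverse T (Fintype.card V) (T.level 0)).val.length + 0) := rfl
  rw [h₃, h.1, List.length_map, List.length_range]
  have := h.2
  omega

/-! ### Isomorphisms -/

namespace UnorderedTree

variable {V₁ V₂ : Type}

/-- The subtrees rooted at two nodes are isomorphic. -/
inductive SubtreeIso (T₁ : UnorderedTree V₁) (T₂ : UnorderedTree V₂) : V₁ → V₂ → Prop
  | mk (u : V₁) (v : V₂) (e : V₁ → V₂)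
      (bij : Set.BijOn e {x | x ∈ T₁.children u} {y | y ∈ T₂.children v})
      (h : ∀ x ∈ T₁.children u, SubtreeIso T₁ T₂ x (e x)) : SubtreeIso T₁ T₂ u v

/-- Nodes that are matched when the roots are matched and the children of two matched nodes `u` and
`v` are matched through `e u v`. -/
inductive Matched (T₁ : UnorderedTree V₁) (T₂ : UnorderedTree V₂) (e : V₁ → V₂ → V₁ → V₂) :
    V₁ → V₂ → Prop
  | root : Matched T₁ T₂ e T₁.root T₂.root
  | child {u : V₁} {v : V₂} {x : V₁} (h : Matched T₁ T₂ e u v) (hx : x ∈ T₁.children u) :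
      Matched T₁ T₂ e x (e u v x)

/-- Choose a matching of children for every pair of nodes and propagate from the roots. Induction
along the path from the root, in either tree, shows that every node is matched exactly once, parents
being unique; the resulting relation is the graph of the isomorphism. -/
theorem isomorphic_of_subtreeIso_root {T₁ : UnorderedTree V₁} {T₂ : UnorderedTree V₂}
    (h : SubtreeIso T₁ T₂ T₁.root T₂.root) : T₁.Isomorphic T₂ := by
  -- Stated for all pairs, with a junk map where the subtrees differ, so that `e` exists before
  -- `Matched` is defined from it.
  have hex : ∀ u v, ∃ e : V₁ → V₂, SubtreeIso T₁ T₂ u v →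
      Set.BijOn e {x | x ∈ T₁.children u} {y | y ∈ T₂.children v} ∧
        ∀ x ∈ T₁.children u, SubtreeIso T₁ T₂ x (e x) := by
    intro u v
    by_cases h : SubtreeIso T₁ T₂ u v
    · obtain ⟨_, _, e, h₁, h₂⟩ := h
      exact ⟨e, fun _ => ⟨h₁, h₂⟩⟩
    · exact ⟨fun _ => v, fun h' => absurd h' h⟩
  choose e he using hex
  have hsub : ∀ {u v}, Matched T₁ T₂ e u v → SubtreeIso T₁ T₂ u v := by
    intro u v huv
    induction huv with
    | root => exact h
    | child _ hx ih => exact (he _ _ ih).2 _ hx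
  have hbij := fun {u v} (huv : Matched T₁ T₂ e u v) => (he u v (hsub huv)).1
  have hmem : ∀ {u v x}, Matched T₁ T₂ e u v → x ∈ T₁.children u → e u v x ∈ T₂.children v :=
    fun huv hx => (hbij huv).mapsTo hx
  have hfun : ∀ x, ∃! y, Matched T₁ T₂ e x y := by
    intro x
    induction T₁.reachable x with
    | refl =>
      refine ⟨T₂.root, .root, ?_⟩
      suffices ∀ r y, Matched T₁ T₂ e r y → r = T₁.root → y = T₂.root from
        fun y hy => this _ y hy rfl
      rintro r y (_ | ⟨-, hx⟩) hr
      · rfl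
      · exact absurd (hr ▸ hx) (T₁.root_notMem_children _)
    | @tail u x _ hx ih =>
      obtain ⟨v, hv, hv'⟩ := ih
      refine ⟨e u v x, .child hv hx, ?_⟩
      rintro y (_ | ⟨h₁, hx'⟩)
      · exact absurd hx (T₁.root_notMem_children _)
      · obtain rfl := T₁.parent_unique _ _ _ hx hx'
        rw [hv' _ h₁]
  have hinj : ∀ y, ∃! x, Matched T₁ T₂ e x y := by
    intro y
    induction T₂.reachable y with
    | refl =>
      refine ⟨T₁.root, .root, ?_⟩
      suffices ∀ x r, Matched T₁ T₂ e x r → r = T₂.root → x = T₁.root from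
        fun x hx => this x _ hx rfl
      rintro x r (_ | ⟨h₁, hx⟩) hr
      · rfl
      · exact absurd (hr ▸ hmem h₁ hx) (T₂.root_notMem_children _)
    | @tail v y _ hy ih =>
      obtain ⟨u, hu, hu'⟩ := ih
      obtain ⟨x, hx, rfl⟩ := (hbij hu).surjOn hy
      refine ⟨x, .child hu hx, ?_⟩
      suffices ∀ x' y', Matched T₁ T₂ e x' y' → y' = e u v x → x' = x from
        fun x' hx' => this x' _ hx' rfl
      rintro x' y' (_ | @⟨u', v', _, h₁, hx'⟩) heq
      · exact absurd (heq ▸ hy) (T₂.root_notMem_children _)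
      · obtain rfl := T₂.parent_unique _ _ _ (hmem h₁ hx') (heq ▸ hy)
        obtain rfl := hu' _ h₁
        exact (hbij hu).injOn hx' hx heq
  choose φ hφ hφ' using hfun
  have hφbij : Function.Bijective φ := by
    refine ⟨fun a b hab => (hinj (φ b)).unique (hab ▸ hφ a) (hφ b), fun y => ?_⟩
    obtain ⟨x, hx, -⟩ := hinj y
    exact ⟨x, (hφ' x y hx).symm⟩
  refine ⟨Equiv.ofBijective φ hφbij, (hφ' _ _ .root).symm, fun u v => ⟨fun hv => ?_, fun hv => ?_⟩⟩
  · change φ v ∈ T₂.children (φ u)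
    rw [← hφ' _ _ (.child (hφ u) hv)]
    exact hmem (hφ u) hv
  · change φ v ∈ T₂.children (φ u) at hv
    obtain ⟨x, hx, hxv⟩ := (hbij (hφ u)).surjOn hv
    have h₁ : Matched T₁ T₂ e x (φ v) := hxv ▸ .child (hφ u) hx
    rwa [(hinj (φ v)).unique (hφ v) h₁]

section

variable {T₁ : UnorderedTree V₁} {T₂ : UnorderedTree V₂} {φ : V₁ ≃ V₂}

theorem children_perm_of_iso (h : ∀ u v, v ∈ T₁.children u ↔ φ v ∈ T₂.children (φ u)) (u : V₁) :
    (T₂.children (φ u)).Perm ((T₁.children u).map φ) := by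
  rw [List.perm_ext_iff_of_nodup (T₂.nodup_children _) ((T₁.nodup_children u).map φ.injective)]
  intro y
  obtain ⟨x, rfl⟩ := φ.surjective y
  rw [← h u x, List.mem_map_of_injective φ.injective]

theorem mem_level_iff_of_iso (h₀ : φ T₁.root = T₂.root)
    (h : ∀ u v, v ∈ T₁.children u ↔ φ v ∈ T₂.children (φ u)) (i : ℕ) (x : V₁) :
    φ x ∈ T₂.level i ↔ x ∈ T₁.level i := by
  induction i generalizing x with
  | zero => simp [level, ← h₀]
  | succ i ih =>
    simp only [mem_level_succ]
    constructor
    · rintro ⟨v, hv, hx⟩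
      obtain ⟨u, rfl⟩ := φ.surjective v
      exact ⟨u, (ih u).1 hv, (h u x).2 hx⟩
    · rintro ⟨u, hu, hx⟩
      exact ⟨φ u, (ih u).2 hu, (h u x).1 hx⟩

theorem level_perm_of_iso (h₀ : φ T₁.root = T₂.root)
    (h : ∀ u v, v ∈ T₁.children u ↔ φ v ∈ T₂.children (φ u)) (i : ℕ) :
    (T₂.level i).Perm ((T₁.level i).map φ) := by
  rw [List.perm_ext_iff_of_nodup (T₂.nodup_level _) ((T₁.nodup_level i).map φ.injective)]
  intro y
  obtain ⟨x, rfl⟩ := φ.surjective y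
  rw [mem_level_iff_of_iso h₀ h, List.mem_map_of_injective φ.injective]

theorem numLevels_eq_of_iso [Fintype V₁] [Fintype V₂] (h₀ : φ T₁.root = T₂.root)
    (h : ∀ u v, v ∈ T₁.children u ↔ φ v ∈ T₂.children (φ u)) : T₁.numLevels = T₂.numLevels := by
  have hnil : ∀ i, T₁.level i = [] ↔ T₂.level i = [] := fun i => by
    rw [← List.length_eq_zero_iff, ← List.length_eq_zero_iff, (level_perm_of_iso h₀ h i).length_eq,
      List.length_map]
  simp only [numLevels, hnil]

end

end UnorderedTree

/-! ### Products of primes -/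

theorem perm_of_prod_eq {l₁ l₂ : List ℕ} (h₁ : ∀ p ∈ l₁, p.Prime) (h₂ : ∀ p ∈ l₂, p.Prime)
    (h : l₁.prod = l₂.prod) : l₁.Perm l₂ :=
  (Nat.primeFactorsList_unique h h₁).trans (Nat.primeFactorsList_unique rfl h₂).symm

/-- Pair the head with an element of equal label, erase both and recurse. The element `b₀` only
supplies values off the list. -/
theorem exists_bijOn_of_map_perm {α β γ : Type} {f : α → γ} {g : β → γ} {l₁ : List α} {l₂ : List β}
    (hd₁ : l₁.Nodup) (hd₂ : l₂.Nodup) (h : (l₁.map f).Perm (l₂.map g)) (b₀ : β) :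
    ∃ e : α → β, Set.BijOn e {x | x ∈ l₁} {y | y ∈ l₂} ∧ ∀ x ∈ l₁, g (e x) = f x := by
  classical
  induction l₁ generalizing l₂ with
  | nil =>
    obtain rfl : l₂ = [] := by simpa using h.symm.eq_nil
    exact ⟨fun _ => b₀, by simp, by simp⟩
  | cons a l₁ ih =>
    obtain ⟨b, hb, hab⟩ := List.mem_map.1 (h.subset List.mem_cons_self)
    have hp := List.perm_cons_erase hb
    rw [List.nodup_cons] at hd₁
    have hd₂' := List.nodup_cons.1 (hp.nodup_iff.1 hd₂)
    obtain ⟨e, he, heq⟩ := ih hd₁.2 hd₂'.2 <| by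
      have := h.trans (hp.map g)
      rw [List.map_cons, List.map_cons, hab] at this
      exact this.cons_inv
    have hcongr : ∀ x ∈ l₁, Function.update e a b x = e x := fun x hx =>
      Function.update_of_ne (by rintro rfl; exact hd₁.1 hx) _ _
    refine ⟨Function.update e a b, ?_, ?_⟩
    · have h₁ : Set.BijOn (Function.update e a b) {x | x ∈ l₁} {y | y ∈ l₂.erase b} :=
        he.congr fun x hx => (hcongr x hx).symm
      have h₂ := h₁.insert (a := a) (by simpa using hd₂'.1)
      convert h₂ using 1
      · ext x; simp
      · ext y; simp [hp.mem_iff]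
    · intro x hx
      rcases List.mem_cons.1 hx with rfl | hx
      · simp [hab]
      · rw [hcongr x hx, heq x hx]

/-! ### Colouring a level -/

/-- The sieve is valid and the dictionary is an injection into the primes used so far. -/
structure LevelState.Valid (st : LevelState) : Prop where
  sieve : st.sieve.Valid
  pos_lt : st.pos < st.sieve.primes.size
  range : ∀ N q, st.f N = some q → ∃ i ≤ st.pos, q = Nat.nth Nat.Prime i
  inj : ∀ N N' q, st.f N = some q → st.f N' = some q → N = N'

theorem LevelState.Valid.prime {st : LevelState} (hs : st.Valid) {N q : ℕ}
    (h : st.f N = some q) : q.Prime := by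
  obtain ⟨i, -, rfl⟩ := hs.range N q h
  exact Nat.prime_nth_prime i

theorem LevelState.Valid.le_bound {st : LevelState} (hs : st.Valid) {N q : ℕ}
    (h : st.f N = some q) : q ≤ st.sieve.bound := by
  obtain ⟨i, hi, rfl⟩ := hs.range N q h
  refine nth_prime_le_of_lt_primeCounting ?_
  rw [← hs.sieve.size_eq]
  exact hi.trans_lt hs.pos_lt

theorem SieveState.Valid.levelState {s : SieveState} (hs : s.Valid) :
    (LevelState.mk s 0 (Function.update (fun _ => none) 1 (some 2))).Valid where
  sieve := hs
  pos_lt := by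
    have h : Nat.primeCounting 16 ≤ Nat.primeCounting s.bound :=
      Nat.monotone_primeCounting hs.sixteen_le
    rw [primeCounting_sixteen, ← hs.size_eq] at h
    change 0 < s.primes.size
    omega
  range N q h := by
    simp only [Function.update_apply] at h
    split_ifs at h
    exact ⟨0, le_rfl, by simpa using h.symm⟩
  inj N N' q h h' := by
    simp only [Function.update_apply] at h h'
    split_ifs at h h'
    subst_vars
    rfl

section

variable {V : Type} [DecidableEq V] (T : UnorderedTree V)

theorem colourNode_spec {st : LevelState} (hs : st.Valid) (c : V → ℕ) (u : V) :
    (colourNode T st c u).val.1.Valid ∧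
      (∀ N q, st.f N = some q → (colourNode T st c u).val.1.f N = some q) ∧
      (colourNode T st c u).val.1.pos ≤ st.pos + 1 ∧
      ∃ q, (colourNode T st c u).val.1.f ((T.children u).map c).prod = some q ∧
        (colourNode T st c u).val.2 = Function.update c u q := by
  simp only [colourNode, Timed.bind_val, timedProd_val]
  split
  next q hq => exact ⟨hs, fun _ _ h => h, by simp, q, hq, rfl⟩
  next hN =>
    obtain ⟨h₁, h₂, h₃, -⟩ := hs.sieve.nextPrime hs.pos_lt
    simp only [Timed.bind_val, Timed.pure_val]
    generalize (nextPrime st.sieve st.pos).val = r at *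
    have hp : r.1.primes.getD r.2 0 = Nat.nth Nat.Prime (st.pos + 1) := by
      rw [h₂, h₁.getD_eq _ h₃]
    -- Values in use are primes of index at most `pos`, so the prime of index `pos + 1` is fresh and
    -- injectivity persists.
    have hnew : ∀ N, st.f N ≠ some (Nat.nth Nat.Prime (st.pos + 1)) := fun N h => by
      obtain ⟨i, hi, he⟩ := hs.range N _ h
      have := nth_prime_injective he
      omega
    rw [hp, h₂]
    refine ⟨⟨h₁, h₃, fun N q h => ?_, fun N N' q h h' => ?_⟩, fun N q h => ?_, le_rfl,
      _, Function.update_self _ _ _, rfl⟩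
    · simp only [Function.update_apply] at h
      split_ifs at h
      · exact ⟨_, le_rfl, by simpa using h.symm⟩
      · obtain ⟨i, hi, he⟩ := hs.range N q h
        exact ⟨i, Nat.le_succ_of_le hi, he⟩
    · simp only [Function.update_apply] at h h'
      split_ifs at h h' with e e' e'
      · rw [e, e']
      · exact absurd (h'.trans h.symm) (hnew _)
      · exact absurd (h.trans h'.symm) (hnew _)
      · exact hs.inj N N' q h h'
    · rw [Function.update_of_ne, h]
      rintro rfl
      rw [hN] at h
      cases h

theorem colourNode_time_le {st : LevelState} (hs : st.Valid) (c : V → ℕ) (u : V) {M a b : ℕ}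
    (hP : (timedProd ((T.children u).map c)).time ≤ 1 + (T.children u).length * a)
    (hM : st.pos + 2 ≤ M) (hb : M * (12 * Nat.size M) ≤ b) (hsb : st.sieve.bound ≤ b) :
    (colourNode T st c u).val.1.sieve.bound ≤ b ∧
      (colourNode T st c u).time + (sieveStepCost (Nat.size b) + 1) * st.sieve.bound ≤
        (1 + (T.children u).length) * (8 + a) +
          (sieveStepCost (Nat.size b) + 1) * (colourNode T st c u).val.1.sieve.bound := by
  have hA : (1 + (T.children u).length) * (8 + a) =
      8 + a + 8 * (T.children u).length + (T.children u).length * a := by ring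
  simp only [colourNode, Timed.bind_val, Timed.bind_time, timedProd_val, tick_time]
  split
  next q hq =>
    refine ⟨hsb, ?_⟩
    simp only [Timed.bind_val, Timed.bind_time, Timed.pure_val, Timed.pure_time, tick_time]
    omega
  next hN =>
    obtain ⟨h₁, h₂⟩ := (hs.sieve.nextPrime hs.pos_lt).2.2.2 M b hM hb hsb
    refine ⟨h₁, ?_⟩
    simp only [Timed.bind_val, Timed.bind_time, Timed.pure_val, Timed.pure_time, tick_time]
    omega

/-- Dictionary entries are never changed, so the final dictionary explains every colour given
earlier. As no child lies in `L`, the products can be expressed with the initial colouring `c`. -/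
theorem colourNodes_spec (L : List V) {st : LevelState} (hs : st.Valid) (c : V → ℕ)
    (hL : ∀ u ∈ L, ∀ x ∈ T.children u, x ∉ L) :
    (colourNodes T L st c).val.1.Valid ∧
      (∀ N q, st.f N = some q → (colourNodes T L st c).val.1.f N = some q) ∧
      (colourNodes T L st c).val.1.pos ≤ st.pos + L.length ∧
      (∀ u ∈ L, (colourNodes T L st c).val.1.f ((T.children u).map c).prod =
        some ((colourNodes T L st c).val.2 u)) ∧
      ∀ x ∉ L, (colourNodes T L st c).val.2 x = c x := by
  induction L generalizing st c with
  | nil => exact ⟨hs, fun _ _ h => h, le_rfl, by simp, fun _ _ => rfl⟩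
  | cons u us ih =>
    obtain ⟨h₁, h₂, h₃, q, h₄, h₅⟩ := colourNode_spec T hs c u
    simp only [colourNodes, Timed.bind_val]
    generalize (colourNode T st c u).val = r at *
    obtain ⟨k₁, k₂, k₃, k₄, k₅⟩ := ih h₁ r.2
      fun v hv x hx h => hL v (List.mem_cons_of_mem _ hv) x hx (List.mem_cons_of_mem _ h)
    have hc : ∀ v ∈ u :: us, (T.children v).map r.2 = (T.children v).map c := by
      intro v hv
      refine List.map_congr_left fun x hx => ?_
      rw [h₅, Function.update_of_ne]
      rintro rfl
      exact hL v hv x hx List.mem_cons_self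
    refine ⟨k₁, fun N q h => k₂ _ _ (h₂ _ _ h), by simp; omega, fun v hv => ?_, fun x hx => ?_⟩
    · by_cases hvs : v ∈ us
      · rw [← hc v hv]; exact k₄ v hvs
      · obtain rfl : v = u := by simpa [hvs] using hv
        rw [k₂ _ _ h₄, k₅ v hvs, h₅, Function.update_self]
    · rw [List.mem_cons, not_or] at hx
      rw [k₅ x hx.2, h₅, Function.update_of_ne hx.1]

theorem colourNodes_time_le (L : List V) {st : LevelState} (hs : st.Valid) (c : V → ℕ)
    (hL : ∀ u ∈ L, ∀ x ∈ T.children u, x ∉ L) {M a b : ℕ}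
    (hP : ∀ u ∈ L, (timedProd ((T.children u).map c)).time ≤ 1 + (T.children u).length * a)
    (hM : st.pos + L.length + 1 ≤ M) (hb : M * (12 * Nat.size M) ≤ b) (hsb : st.sieve.bound ≤ b) :
    (colourNodes T L st c).val.1.sieve.bound ≤ b ∧
      (colourNodes T L st c).time + (sieveStepCost (Nat.size b) + 1) * st.sieve.bound ≤
        T.workload L * (8 + a) +
          (sieveStepCost (Nat.size b) + 1) * (colourNodes T L st c).val.1.sieve.bound := by
  induction L generalizing st c with
  | nil => exact ⟨hsb, by simp [colourNodes]⟩
  | cons u us ih =>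
    rw [List.length_cons] at hM
    obtain ⟨h₁, -, h₃, q, -, h₅⟩ := colourNode_spec T hs c u
    obtain ⟨t₁, t₂⟩ := colourNode_time_le T hs c u (hP u List.mem_cons_self) (by omega) hb hsb
    simp only [colourNodes, Timed.bind_val, Timed.bind_time]
    generalize (colourNode T st c u).val = r at *
    obtain ⟨k₁, k₂⟩ := ih h₁ r.2
      (fun v hv x hx h => hL v (List.mem_cons_of_mem _ hv) x hx (List.mem_cons_of_mem _ h))
      (fun v hv => by
        have hc : (T.children v).map r.2 = (T.children v).map c := by
          refine List.map_congr_left fun x hx => ?_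
          rw [h₅, Function.update_of_ne]
          rintro rfl
          exact hL v (List.mem_cons_of_mem _ hv) x hx List.mem_cons_self
        rw [hc]
        exact hP v (List.mem_cons_of_mem _ hv))
      (by omega) t₁
    refine ⟨k₁, ?_⟩
    rw [UnorderedTree.workload_cons, add_mul _ (T.workload us)]
    omega

end

/-! ### Comparing two levels -/

theorem fillHoles_val {V : Type} (c : V → ℕ) (L : List V) (h : ℕ → ℕ) (q : ℕ) :
    (fillHoles c L h).val q = h q + (L.map c).count q := by
  induction L generalizing h with
  | nil => rfl
  | cons u us ih =>
    simp only [fillHoles, Timed.bind_val, ih, List.map_cons, List.count_cons, Function.update_apply]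
    by_cases e : q = c u
    · subst e; simp; ring
    · simp [e, Ne.symm e]

theorem fillHoles_time {V : Type} (c : V → ℕ) (L : List V) (h : ℕ → ℕ) :
    (fillHoles c L h).time = L.length := by
  induction L generalizing h with
  | nil => rfl
  | cons u us ih => simp [fillHoles, ih, add_comm]

theorem compareHoles_val (p : Array ℕ) (h₁ h₂ : ℕ → ℕ) (k : ℕ) :
    (compareHoles p h₁ h₂ k).val = true ↔ ∀ i < k, h₁ (p.getD i 0) = h₂ (p.getD i 0) := by
  induction k with
  | zero => simp [compareHoles]
  | succ k ih =>
    simp only [compareHoles, Timed.bind_val, Nat.forall_lt_succ_right, ← ih]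
    split_ifs with h
    · exact (and_iff_left h).symm
    · simp [h, -Array.getD_eq_getD_getElem?]

theorem compareHoles_time_le (p : Array ℕ) (h₁ h₂ : ℕ → ℕ) (k : ℕ) :
    (compareHoles p h₁ h₂ k).time ≤ k + 1 := by
  induction k with
  | zero => simp [compareHoles]
  | succ k ih =>
    simp only [compareHoles, Timed.bind_time, tick_time]
    split_ifs
    · omega
    · simp

/-- All colours of the level are among the first `pos + 1` primes; outside these holes both counts
vanish. -/
theorem LevelState.Valid.compareHoles_iff {st : LevelState} (hs : st.Valid) {V₁ V₂ : Type}
    {L₁ : List V₁} {L₂ : List V₂} {c₁ : V₁ → ℕ} {c₂ : V₂ → ℕ} {N₁ : V₁ → ℕ} {N₂ : V₂ → ℕ}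
    (h₁ : ∀ u ∈ L₁, st.f (N₁ u) = some (c₁ u)) (h₂ : ∀ u ∈ L₂, st.f (N₂ u) = some (c₂ u)) :
    (compareHoles st.sieve.primes (fillHoles c₁ L₁ fun _ => 0).val
      (fillHoles c₂ L₂ fun _ => 0).val (st.pos + 1)).val = true ↔
      (L₁.map c₁).Perm (L₂.map c₂) := by
  simp only [compareHoles_val, fillHoles_val, zero_add]
  rw [List.perm_iff_count]
  constructor
  · intro h q
    by_cases hq : ∃ i ≤ st.pos, q = Nat.nth Nat.Prime i
    · obtain ⟨i, hi, rfl⟩ := hq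
      have := h i (Nat.lt_succ_of_le hi)
      rwa [hs.sieve.getD_eq i (hi.trans_lt hs.pos_lt)] at this
    · rw [List.count_eq_zero_of_not_mem, List.count_eq_zero_of_not_mem]
      · intro hm
        obtain ⟨u, hu, rfl⟩ := List.mem_map.1 hm
        exact hq (hs.range _ _ (h₂ u hu))
      · intro hm
        obtain ⟨u, hu, rfl⟩ := List.mem_map.1 hm
        exact hq (hs.range _ _ (h₁ u hu))
  · exact fun h i _ => h _

/-! ### The main loop -/

section

variable {V₁ V₂ : Type} [DecidableEq V₁] [DecidableEq V₂]
  (T₁ : UnorderedTree V₁) (T₂ : UnorderedTree V₂)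

/-- One round of the main loop, abstracted to the data on which correctness and running time both
depend: a valid dictionary that explains both new colourings, and the resulting recursion for the
value and the time. -/
theorem processLevels_cons {L₁ : List V₁} {L₂ : List V₂} (R₁ : List (List V₁))
    (R₂ : List (List V₂)) {s : SieveState} (hs : s.Valid) (c₁ : V₁ → ℕ) (c₂ : V₂ → ℕ)
    (hL₁ : ∀ u ∈ L₁, ∀ x ∈ T₁.children u, x ∉ L₁) (hL₂ : ∀ u ∈ L₂, ∀ x ∈ T₂.children u, x ∉ L₂) :
    ∃ (st : LevelState) (c₁' : V₁ → ℕ) (c₂' : V₂ → ℕ), st.Valid ∧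
      (∀ u ∈ L₁, st.f ((T₁.children u).map c₁).prod = some (c₁' u)) ∧
      (∀ u ∈ L₂, st.f ((T₂.children u).map c₂).prod = some (c₂' u)) ∧
      ((processLevels T₁ T₂ (L₁ :: R₁) (L₂ :: R₂) s c₁ c₂).val = true ↔
        (L₁.map c₁').Perm (L₂.map c₂') ∧
          (processLevels T₁ T₂ R₁ R₂ st.sieve c₁' c₂').val = true) ∧
      ∀ M a b,
        (∀ u ∈ L₁, (timedProd ((T₁.children u).map c₁)).time ≤ 1 + (T₁.children u).length * a) →
        (∀ u ∈ L₂, (timedProd ((T₂.children u).map c₂)).time ≤ 1 + (T₂.children u).length * a) →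
        L₁.length + L₂.length + 1 ≤ M → M * (12 * Nat.size M) ≤ b → s.bound ≤ b →
        st.sieve.bound ≤ b ∧
          (processLevels T₁ T₂ (L₁ :: R₁) (L₂ :: R₂) s c₁ c₂).time +
              (sieveStepCost (Nat.size b) + 1) * s.bound ≤
            4 + (T₁.workload L₁ + T₂.workload L₂) * (10 + a) +
              (processLevels T₁ T₂ R₁ R₂ st.sieve c₁' c₂').time +
                (sieveStepCost (Nat.size b) + 1) * st.sieve.bound := by
  have hst := hs.levelState
  obtain ⟨h₁, -, h₃, h₄, -⟩ := colourNodes_spec T₁ L₁ hst c₁ hL₁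
  have ht₁ := fun M a b => colourNodes_time_le T₁ L₁ hst c₁ hL₁ (M := M) (a := a) (b := b)
  simp only [processLevels, Timed.bind_val, Timed.bind_time, tick_time]
  generalize hx₁ : colourNodes T₁ L₁
    ⟨s, 0, Function.update (fun _ => none) 1 (some 2)⟩ c₁ = r₁ at *
  obtain ⟨k₁, k₂, k₃, k₄, -⟩ := colourNodes_spec T₂ L₂ h₁ c₂ hL₂
  have ht₂ := fun M a b => colourNodes_time_le T₂ L₂ h₁ c₂ hL₂ (M := M) (a := a) (b := b)
  generalize hx₂ : colourNodes T₂ L₂ r₁.val.1 c₂ = r₂ at *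
  have h₄' := fun u hu => k₂ _ _ (h₄ u hu)
  have hcmp := k₁.compareHoles_iff h₄' k₄
  have hcmpt := compareHoles_time_le r₂.val.1.sieve.primes (fillHoles r₁.val.2 L₁ fun _ => 0).val
      (fillHoles r₂.val.2 L₂ fun _ => 0).val (r₂.val.1.pos + 1)
  generalize compareHoles r₂.val.1.sieve.primes (fillHoles r₁.val.2 L₁ fun _ => 0).val
      (fillHoles r₂.val.2 L₂ fun _ => 0).val (r₂.val.1.pos + 1) = r₃ at *
  refine ⟨r₂.val.1, r₁.val.2, r₂.val.2, k₁, h₄', k₄, ?_, ?_⟩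
  · rw [← hcmp]
    split_ifs with h <;> simp [h]
  · intro M a b hP₁ hP₂ hM hb hsb
    simp only [zero_add] at h₃
    obtain ⟨b₁, e₁⟩ := ht₁ M a b hP₁ (by simp; omega) hb hsb
    obtain ⟨b₂, e₂⟩ := ht₂ M a b hP₂ (by omega) hb b₁
    refine ⟨b₂, ?_⟩
    have w₁ : L₁.length ≤ T₁.workload L₁ := Nat.le_add_right _ _
    have w₂ : L₂.length ≤ T₂.workload L₂ := Nat.le_add_right _ _
    -- The rate rises from `8` to `10` to pay for filling the holes and for comparing them, as `pos`
    -- is at most the number of nodes of the level.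
    have ha : (T₁.workload L₁ + T₂.workload L₂) * (10 + a) = T₁.workload L₁ * (8 + a) +
        T₂.workload L₂ * (8 + a) + 2 * T₁.workload L₁ + 2 * T₂.workload L₂ := by ring
    rw [fillHoles_time, fillHoles_time]
    simp only at e₁
    split_ifs with h
    · omega
    · simp only [Timed.pure_time]
      omega

/-- The hypotheses describe level `k`, just completed, while the levels above it are still to come.
At `k = 0` only the roots remain, and their colours agree by `hperm`. -/
theorem subtreeIso_of_processLevels (k : ℕ) {s : SieveState} (hs : s.Valid) {c₁ : V₁ → ℕ}
    {c₂ : V₂ → ℕ} (hp₁ : ∀ u ∈ T₁.level k, (c₁ u).Prime) (hp₂ : ∀ v ∈ T₂.level k, (c₂ v).Prime)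
    (hiso : ∀ u ∈ T₁.level k, ∀ v ∈ T₂.level k, c₁ u = c₂ v → T₁.SubtreeIso T₂ u v)
    (hperm : ((T₁.level k).map c₁).Perm ((T₂.level k).map c₂))
    (h : (processLevels T₁ T₂ (T₁.levelsUpTo k) (T₂.levelsUpTo k) s c₁ c₂).val = true) :
    T₁.SubtreeIso T₂ T₁.root T₂.root := by
  induction k generalizing s c₁ c₂ with
  | zero =>
    refine hiso _ (List.mem_singleton_self _) _ (List.mem_singleton_self _) ?_
    simpa [UnorderedTree.level] using hperm
  | succ k ih =>
    obtain ⟨st, c₁', c₂', h₁, h₂, h₃, h₄, -⟩ := processLevels_cons T₁ T₂ (T₁.levelsUpTo k)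
      (T₂.levelsUpTo k) hs c₁ c₂ (L₁ := T₁.level k) (L₂ := T₂.level k)
      (fun u hu x hx => UnorderedTree.children_notMem_level hu hx)
      (fun u hu x hx => UnorderedTree.children_notMem_level hu hx)
    obtain ⟨h₅, h₆⟩ := h₄.1 h
    refine ih h₁.sieve (fun u hu => h₁.prime (h₂ u hu)) (fun v hv => h₁.prime (h₃ v hv)) ?_ h₅ h₆
    intro u hu v hv huv
    have hu' : ∀ x ∈ T₁.children u, x ∈ T₁.level (k + 1) := fun x hx =>
      UnorderedTree.mem_level_succ.2 ⟨u, hu, hx⟩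
    have hv' : ∀ y ∈ T₂.children v, y ∈ T₂.level (k + 1) := fun y hy =>
      UnorderedTree.mem_level_succ.2 ⟨v, hv, hy⟩
    have hprod := h₁.inj _ _ _ (h₂ u hu) (huv ▸ h₃ v hv)
    have hchildren := perm_of_prod_eq (List.forall_mem_map.2 fun x hx => hp₁ x (hu' x hx))
      (List.forall_mem_map.2 fun y hy => hp₂ y (hv' y hy)) hprod
    obtain ⟨e, he, hce⟩ := exists_bijOn_of_map_perm (T₁.nodup_children u) (T₂.nodup_children v)
      hchildren v
    exact ⟨u, v, e, he, fun x hx => hiso _ (hu' x hx) _ (hv' _ (he.mapsTo hx)) (hce x hx).symm⟩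

theorem processLevels_of_iso {φ : V₁ ≃ V₂} (h₀ : φ T₁.root = T₂.root)
    (h : ∀ u v, v ∈ T₁.children u ↔ φ v ∈ T₂.children (φ u)) (k : ℕ) {s : SieveState}
    (hs : s.Valid) {c₁ : V₁ → ℕ} {c₂ : V₂ → ℕ} (hc : ∀ u ∈ T₁.level k, c₂ (φ u) = c₁ u) :
    (processLevels T₁ T₂ (T₁.levelsUpTo k) (T₂.levelsUpTo k) s c₁ c₂).val = true := by
  induction k generalizing s c₁ c₂ with
  | zero => rfl
  | succ k ih =>
    obtain ⟨st, c₁', c₂', h₁, h₂, h₃, h₄, -⟩ := processLevels_cons T₁ T₂ (T₁.levelsUpTo k)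
      (T₂.levelsUpTo k) hs c₁ c₂ (L₁ := T₁.level k) (L₂ := T₂.level k)
      (fun u hu x hx => UnorderedTree.children_notMem_level hu hx)
      (fun u hu x hx => UnorderedTree.children_notMem_level hu hx)
    have hc' : ∀ u ∈ T₁.level k, c₂' (φ u) = c₁' u := by
      intro u hu
      have hprod : ((T₂.children (φ u)).map c₂).prod = ((T₁.children u).map c₁).prod := by
        rw [((UnorderedTree.children_perm_of_iso h u).map c₂).prod_eq, List.map_map]
        congr 1
        exact List.map_congr_left fun x hx => hc x (UnorderedTree.mem_level_succ.2 ⟨u, hu, hx⟩)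
      have h₅ := h₃ _ ((UnorderedTree.mem_level_iff_of_iso h₀ h k u).2 hu)
      rw [hprod, h₂ u hu] at h₅
      exact (Option.some.inj h₅).symm
    refine h₄.2 ⟨?_, ih h₁.sieve hc'⟩
    have := (UnorderedTree.level_perm_of_iso h₀ h k).map c₂'
    rw [List.map_map, List.map_congr_left (f := c₂' ∘ φ) (g := c₁') hc'] at this
    exact this.symm

theorem processLevels_time_le [Fintype V₁] [Fintype V₂] {n a b : ℕ}
    (hn₁ : Fintype.card V₁ ≤ n) (hn₂ : Fintype.card V₂ ≤ n)
    (ha : ∀ l : List ℕ, l.length ≤ n → (∀ x ∈ l, x ≤ b) →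
      (timedProd l).time ≤ 1 + l.length * a)
    (hb : (2 * n + 1) * (12 * Nat.size (2 * n + 1)) ≤ b)
    (k : ℕ) (hk : k ≤ T₁.numLevels) {s : SieveState} (hs : s.Valid) (hsb : s.bound ≤ b)
    {c₁ : V₁ → ℕ} {c₂ : V₂ → ℕ} (hc₁ : ∀ u ∈ T₁.level k, c₁ u ≤ b)
    (hc₂ : ∀ v ∈ T₂.level k, c₂ v ≤ b) :
    (processLevels T₁ T₂ (T₁.levelsUpTo k) (T₂.levelsUpTo k) s c₁ c₂).time +
        (sieveStepCost (Nat.size b) + 1) * s.bound ≤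
      1 + (∑ i ∈ Finset.range k, T₁.workload (T₁.level i) +
        ∑ i ∈ Finset.range k, T₂.workload (T₂.level i)) * (14 + a) +
        (sieveStepCost (Nat.size b) + 1) * b := by
  induction k generalizing s c₁ c₂ with
  | zero =>
    have := Nat.mul_le_mul_left (sieveStepCost (Nat.size b) + 1) hsb
    simpa [UnorderedTree.levelsUpTo, processLevels] using this
  | succ k ih =>
    obtain ⟨st, c₁', c₂', h₁, h₂, h₃, -, h₅⟩ := processLevels_cons T₁ T₂ (T₁.levelsUpTo k)
      (T₂.levelsUpTo k) hs c₁ c₂ (L₁ := T₁.level k) (L₂ := T₂.level k)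
      (fun u hu x hx => UnorderedTree.children_notMem_level hu hx)
      (fun u hu x hx => UnorderedTree.children_notMem_level hu hx)
    have hl₁ := (T₁.nodup_level k).length_le_card
    have hl₂ := (T₂.nodup_level k).length_le_card
    obtain ⟨h₆, h₇⟩ := h₅ (2 * n + 1) a b
      (fun u hu => by
        have := ha ((T₁.children u).map c₁)
          (by rw [List.length_map]; exact (T₁.nodup_children u).length_le_card.trans hn₁)
          (List.forall_mem_map.2 fun x hx =>
            hc₁ x (UnorderedTree.mem_level_succ.2 ⟨u, hu, hx⟩))
        rwa [List.length_map] at this)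
      (fun u hu => by
        have := ha ((T₂.children u).map c₂)
          (by rw [List.length_map]; exact (T₂.nodup_children u).length_le_card.trans hn₂)
          (List.forall_mem_map.2 fun x hx =>
            hc₂ x (UnorderedTree.mem_level_succ.2 ⟨u, hu, hx⟩))
        rwa [List.length_map] at this)
      (by omega) hb hsb
    have h₈ := ih (by omega) h₁.sieve h₆ (fun u hu => (h₁.le_bound (h₂ u hu)).trans h₆)
      (fun v hv => (h₁.le_bound (h₃ v hv)).trans h₆)
    -- A level of `T₁` is nonempty, so the constant `4` per round is absorbed into the workload,
    -- turning `10 + a` into `14 + a`.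
    have hpos : 1 ≤ T₁.workload (T₁.level k) :=
      (List.length_pos_iff.2 (UnorderedTree.level_ne_nil (by omega))).trans_le
        (Nat.le_add_right _ _)
    rw [Finset.sum_range_succ, Finset.sum_range_succ]
    simp only [UnorderedTree.levelsUpTo]
    generalize T₁.workload (T₁.level k) = w₁ at *
    generalize T₂.workload (T₂.level k) = w₂ at *
    generalize ∑ i ∈ Finset.range k, T₁.workload (T₁.level i) = S₁ at *
    generalize ∑ i ∈ Finset.range k, T₂.workload (T₂.level i) = S₂ at *
    have e : (S₁ + w₁ + (S₂ + w₂)) * (14 + a) =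
        (S₁ + S₂) * (14 + a) + ((w₁ + w₂) * (10 + a) + 4 * w₁ + 4 * w₂) := by ring
    omega

end

/-! ### The algorithm -/

theorem primesAHU_val_iff {V₁ V₂ : Type} [Fintype V₁] [Fintype V₂] [DecidableEq V₁]
    [DecidableEq V₂] (T₁ : UnorderedTree V₁) (T₂ : UnorderedTree V₂) :
    (primesAHU T₁ T₂).val = true ↔ T₁.Isomorphic T₂ := by
  simp only [primesAHU, Timed.bind_val, levels_val, UnorderedTree.length_levelsUpTo]
  constructor
  · intro h
    split_ifs at h with hlen
    -- The induction starts at the empty level below the deepest nodes, where every hypothesis on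
    -- colours is vacuous.
    have hnil₂ : T₂.level T₁.numLevels = [] := hlen ▸ T₂.level_numLevels
    exact UnorderedTree.isomorphic_of_subtreeIso_root
      (subtreeIso_of_processLevels T₁ T₂ T₁.numLevels initialSieve_valid
        (by simp [T₁.level_numLevels]) (by simp [hnil₂]) (by simp [hnil₂])
        (by simp [T₁.level_numLevels, hnil₂]) (by simpa [← hlen] using h))
  · rintro ⟨φ, h₀, h⟩
    have hlen := UnorderedTree.numLevels_eq_of_iso h₀ h
    rw [if_pos hlen, ← hlen]
    refine processLevels_of_iso T₁ T₂ h₀ h T₁.numLevels initialSieve_valid ?_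
    simp [T₁.level_numLevels]

theorem primesAHU_time_le_of_bound {V₁ V₂ : Type} [Fintype V₁] [Fintype V₂] [DecidableEq V₁]
    [DecidableEq V₂] (T₁ : UnorderedTree V₁) (T₂ : UnorderedTree V₂) {n a b : ℕ}
    (hn₁ : Fintype.card V₁ = n) (hn₂ : Fintype.card V₂ = n)
    (ha : ∀ l : List ℕ, l.length ≤ n → (∀ x ∈ l, x ≤ b) →
      (timedProd l).time ≤ 1 + l.length * a)
    (hb : (2 * n + 1) * (12 * Nat.size (2 * n + 1)) ≤ b) (hb' : 16 ≤ b) :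
    (primesAHU T₁ T₂).time ≤
      6 + 8 * n + 4 * n * (14 + a) + (sieveStepCost (Nat.size b) + 1) * b := by
  have h₁ := levels_time_le T₁
  have h₂ := levels_time_le T₂
  have hw₁ := T₁.sum_workload_level_le T₁.numLevels
  have hw₂ := T₂.sum_workload_level_le T₁.numLevels
  simp only [primesAHU, Timed.bind_time, tick_time, levels_val,
    UnorderedTree.length_levelsUpTo]
  split_ifs with hlen
  · have h₃ := processLevels_time_le T₁ T₂ hn₁.le hn₂.le ha hb T₁.numLevels le_rfl
      initialSieve_valid hb' (c₁ := fun _ => 0) (c₂ := fun _ => 0) (by simp) (by simp)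
    rw [← hlen]
    simp only [Timed.bind_time, tick_time]
    have h₄ := Nat.mul_le_mul_right (14 + a) (show
      ∑ i ∈ Finset.range T₁.numLevels, T₁.workload (T₁.level i) +
        ∑ i ∈ Finset.range T₁.numLevels, T₂.workload (T₂.level i) ≤ 4 * n by omega)
    omega
  · simp only [Timed.pure_time]
    omega

theorem timedProd_time_le_of_le {n b L : ℕ} (hL : 0 < L) (hn : Nat.size n ≤ L)
    (hb : Nat.size b ≤ 9 * L) (l : List ℕ) (hl : l.length ≤ n) (hlb : ∀ x ∈ l, x ≤ b) :
    (timedProd l).time ≤ 1 + l.length * (L * (2 + 1210 * L ^ 3)) := by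
  -- The operands have at most `k * (10 * L)` bits, a number whose own size is at most `L + 10 * L`;
  -- hence `1210 = 10 * 11 ^ 2`.
  have hg : ∀ k, k ≤ n → mulCost (k * (9 * L + 1)) ≤ k * (1210 * L ^ 3) := by
    intro k hk
    have h₁ : Nat.size (k * (10 * L)) ≤ 11 * L := by
      have := Nat.size_mul_le k (10 * L)
      have := Nat.size_le_size hk
      have := Nat.size_le_self (10 * L)
      omega
    calc mulCost (k * (9 * L + 1)) ≤ mulCost (k * (10 * L)) :=
          mulCost_mono (Nat.mul_le_mul_left _ (by omega))
      _ ≤ k * (10 * L) * (11 * L) ^ 2 := mulCost_le_mul_sq h₁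
      _ = k * (1210 * L ^ 3) := by ring
  have h := timedProd_time_le (S := 9 * L) n hg l hl
    fun x hx => (Nat.size_le_size (hlb x hx)).trans hb
  have hc : Nat.clog 2 l.length ≤ L :=
    Nat.clog_le_of_le_pow (hl.trans ((Nat.size_le.1 hn).le))
  exact h.trans (by gcongr)

theorem primesAHU_time_le {V₁ V₂ : Type} [Fintype V₁] [Fintype V₂] [DecidableEq V₁]
    [DecidableEq V₂] (T₁ : UnorderedTree V₁) (T₂ : UnorderedTree V₂) {n : ℕ}
    (hn₁ : Fintype.card V₁ = n) (hn₂ : Fintype.card V₂ = n) :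
    (primesAHU T₁ T₂).time ≤ 90000 * Nat.size n ^ 4 * n := by
  have hn : 0 < n := hn₁ ▸ Fintype.card_pos_iff.2 ⟨T₁.root⟩
  obtain ⟨L, hL⟩ : ∃ L, Nat.size n = L := ⟨_, rfl⟩
  have hL₀ : 0 < L := hL ▸ Nat.size_pos.2 hn
  -- Take `b = 108 * (n * L)`, where `108 = 3 * 12 * 3` comes from `2 * n + 1 ≤ 3 * n` and `Nat.size
  -- (2 * n + 1) ≤ 3 * L`.
  have hb₁ : Nat.size (108 * (n * L)) ≤ 9 * L := by
    have h₁ := Nat.size_mul_le 108 (n * L)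
    have h₂ := Nat.size_mul_le n L
    have h₃ := Nat.size_le_self L
    have h₄ : Nat.size 108 = 7 := by decide +kernel
    omega
  have hb₂ : (2 * n + 1) * (12 * Nat.size (2 * n + 1)) ≤ 108 * (n * L) := by
    have h₁ : Nat.size (2 * n + 1) ≤ 3 * L := by
      have h₂ := Nat.size_le_size (show 2 * n + 1 ≤ 3 * n by omega)
      have h₃ := Nat.size_mul_le 3 n
      have h₄ : Nat.size 3 = 2 := by decide +kernel
      omega
    calc (2 * n + 1) * (12 * Nat.size (2 * n + 1)) ≤ (3 * n) * (12 * (3 * L)) := by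
          gcongr; omega
      _ = _ := by ring
  have hnL : 1 ≤ n * L := Nat.mul_pos hn hL₀
  have h := primesAHU_time_le_of_bound T₁ T₂ hn₁ hn₂
    (timedProd_time_le_of_le hL₀ hL.le hb₁) hb₂ (by omega)
  have hσ : sieveStepCost (Nat.size (108 * (n * L))) + 1 ≤ 742 * L ^ 3 := by
    have h₁ : mulCost (9 * L) ≤ 9 * L * (9 * L) ^ 2 := mulCost_le_mul_sq (Nat.size_le_self _)
    have h₂ := mulCost_mono hb₁
    have h₃ : L ≤ L ^ 3 := Nat.le_self_pow (by omega) L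
    have h₄ : 9 * L * (9 * L) ^ 2 = 729 * L ^ 3 := by ring
    unfold sieveStepCost
    omega
  have hL₄ : L ≤ L ^ 4 := Nat.le_self_pow (by omega) L
  rw [hL]
  calc _ ≤ _ := h
    _ ≤ 6 * n + 8 * n + 4 * n * (14 + L * (2 + 1210 * L ^ 3)) +
        742 * L ^ 3 * (108 * (n * L)) := by gcongr; omega
    _ = (70 + 2 * (4 * L) + (4 * 1210 + 742 * 108) * L ^ 4) * n := by ring
    _ ≤ 90000 * L ^ 4 * n := by gcongr; omega

theorem mainTheorem1 :
    (∀ (V₁ V₂ : Type) [Fintype V₁] [Fintype V₂] [DecidableEq V₁] [DecidableEq V₂]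
        (T₁ : UnorderedTree V₁) (T₂ : UnorderedTree V₂),
        (primesAHU T₁ T₂).val = true ↔ T₁.Isomorphic T₂) ∧
    ∃ C : Polynomial ℝ,
      ∀ (K : ℝ) (n : ℕ) (V₁ V₂ : Type) [Fintype V₁] [Fintype V₂]
        [DecidableEq V₁] [DecidableEq V₂] (T₁ : UnorderedTree V₁) (T₂ : UnorderedTree V₂),
        Fintype.card V₁ = n → Fintype.card V₂ = n → Real.logb 2 n ≤ K →
          ((primesAHU T₁ T₂).time : ℝ) ≤ C.eval K * n := by
  -- The polynomial is the explicit bound with `Nat.size n = ⌊log₂ n⌋ + 1` replaced by `K + 1`.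
  refine ⟨fun V₁ V₂ _ _ _ _ T₁ T₂ => primesAHU_val_iff T₁ T₂,
    Polynomial.C 90000 * (Polynomial.X + 1) ^ 4, ?_⟩
  intro K n V₁ V₂ _ _ _ _ T₁ T₂ hn₁ hn₂ hK
  have hn : 0 < n := hn₁ ▸ Fintype.card_pos_iff.2 ⟨T₁.root⟩
  have hsize : (Nat.size n : ℝ) ≤ K + 1 := by
    obtain ⟨k, hk⟩ : ∃ k, Nat.size n = k + 1 :=
      Nat.exists_eq_succ_of_ne_zero (Nat.size_pos.2 hn).ne'
    have h₁ : 2 ^ k ≤ n := Nat.lt_size.1 (by omega)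
    have h₂ : (k : ℝ) ≤ Real.logb 2 n := by
      rw [Real.le_logb_iff_rpow_le one_lt_two (by exact_mod_cast hn), Real.rpow_natCast]
      exact_mod_cast h₁
    rw [hk]
    push_cast
    linarith
  have h : ((primesAHU T₁ T₂).time : ℝ) ≤ 90000 * (Nat.size n : ℝ) ^ 4 * n := by
    exact_mod_cast primesAHU_time_le T₁ T₂ hn₁ hn₂
  simp only [Polynomial.eval_mul, Polynomial.eval_C, Polynomial.eval_pow, Polynomial.eval_add,
    Polynomial.eval_X, Polynomial.eval_one]
  exact h.trans (by gcongr)
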